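/- A *basic ellitope* of ellitopic size $K\ge 1$ is a set $$\mathcal W=\{w\in\mathbf R^p:\ \exists t\in\mathcal T:\ w^TT_kw\le t_k,\ 1\le k\le K\},$$ where $T_1,\dots,T_K$ are symmetric positive semidefinite $p\times p$ matrices with $\sum_kT_k\succ0$, and $\mathcal T\subset\mathbf R^K_+$ is a convex compact set with nonempty interior which is monotone: $0\le t\le t'$ and $t'\in\mathcal T$ imply $t\in\mathcal T$. An *ellitope* of ellitopic size $K$ is a linear image $P\mathcal W$ of such a set. For a convex compact set $\mathcal U$ symmetric w.r.t. the origin, with nonempty interior, $\|\cdot\|_{\mathcal U}$ is the norm with unit ball $\mathcal U$, and $\phi_{\mathcal T}(\lambda)=\max_{t\in\mathcal T}\lambda^Tt$. **Theorem.** Let $$\mathcal X=P\mathcal W\subset\mathbf R^n,\qquad \mathcal W=\{w\in\mathbf R^p:\exists t\in\mathcal T:\ w^TT_kw\le t_k,\ k\le K\},$$ be an ellitope of ellitopic size $K$ with nonempty interior. Let $\mathcal B,\mathcal B_*\subset\mathbf R^m$ be polars of each other, i.e. $\mathcal B=\{v:v^Ty\le1\ \forall y\in\mathcal B_*\}$ and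 $\mathcal B_*=\{y:y^Tv\le1\ \forall v\in\mathcal B\}$, and let $$\mathcal B_*=Q\mathcal Z,\qquad \mathcal Z=\{z\in\mathbf R^q:\exists s\in\mathcal S:\ z^TS_\ell z\le s_\ell,\ \ell\le L\},$$ be an ellitope of ellitopic size $L$ with nonempty interior. For a real $m\times n$ matrix $A$ put $$\|A\|_{\mathcal B,\mathcal X}=\max_x\{\|Ax\|_{\mathcal B}:\ \|x\|_{\mathcal X}\le1\},$$ $$\mathrm{Opt}(A)=\min_{\lambda,\upsilon}\left\{\phi_{\mathcal T}(\lambda)+\phi_{\mathcal S}(\upsilon):\ \lambda\ge0,\ \upsilon\ge0,\ \begin{bmatrix}\sum_\ell\upsilon_\ell S_\ell&\tfrac12Q^TAP\\ \tfrac12P^TA^TQ&\sum_k\lambda_kT_k\end{bmatrix}\succeq0\right\}.$$ Then the maximum and the minimum are attained, and $$\|A\|_{\mathcal B,\mathcal X}\ \le\ \mathrm{Opt}(A)\ \le\ \varsigma(K,L)\,\|A\|_{\mathcal B,\mathcal X},\qquad \varsigma(K,L)=\begin{cases}3\sqrt{\ln(4K)\ln(4L)},&\max[K,L]>1,\\ 1,&K=L=1.\end{cases}$$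 In particular, $\mathrm{Opt}(A)=\|A\|_{\mathcal B,\mathcal X}$ when $K=L=1$. -/

import Mathlib

open scoped Matrix

namespace EllitopicNorm

/-- The data `(T_k)_{k ≤ K}`, `𝒯` of a basic ellitope of ellitopic size `K` in `ℝᵖ`: the matrices
`T_k` are symmetric positive semidefinite with positive definite sum, and `𝒯` is a convex compact
monotone subset of the nonnegative orthant of `ℝᴷ` with nonempty interior. -/
structure IsBasicEllitopeData {p K : ℕ} (T : Fin K → Matrix (Fin p) (Fin p) ℝ)
    (𝒯 : Set (Fin K → ℝ)) : Prop where
  posSemidef : ∀ k, (T k).PosSemidef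
  posDef_sum : (∑ k, T k).PosDef
  convex : Convex ℝ 𝒯
  isCompact : IsCompact 𝒯
  nonneg : ∀ t ∈ 𝒯, 0 ≤ t
  monotone : ∀ t t' : Fin K → ℝ, 0 ≤ t → t ≤ t' → t' ∈ 𝒯 → t ∈ 𝒯
  interior_nonempty : (interior 𝒯).Nonempty

/-- The basic ellitope `{w ∈ ℝᵖ : ∃ t ∈ 𝒯, wᵀ T_k w ≤ t_k for all k ≤ K}`. -/
def basicEllitope {p K : ℕ} (T : Fin K → Matrix (Fin p) (Fin p) ℝ)
    (𝒯 : Set (Fin K → ℝ)) : Set (Fin p → ℝ) :=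
  {w | ∃ t ∈ 𝒯, ∀ k, w ⬝ᵥ (T k *ᵥ w) ≤ t k}

/-- The ellitope `P 𝒲`, the image of the basic ellitope `𝒲` with data `T`, `𝒯` under `w ↦ P w`. -/
def ellitope {n p K : ℕ} (P : Matrix (Fin n) (Fin p) ℝ) (T : Fin K → Matrix (Fin p) (Fin p) ℝ)
    (𝒯 : Set (Fin K → ℝ)) : Set (Fin n → ℝ) :=
  {x | ∃ w ∈ basicEllitope T 𝒯, x = P *ᵥ w}

/-- The polar `{v ∈ ℝᵐ : vᵀ y ≤ 1 for all y ∈ C}` of a set `C ⊆ ℝᵐ`. -/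
def polar {m : ℕ} (C : Set (Fin m → ℝ)) : Set (Fin m → ℝ) :=
  {v | ∀ y ∈ C, v ⬝ᵥ y ≤ 1}

/-- The values `‖A x‖_ℬ` over `x` with `‖x‖_𝒳 ≤ 1`. The norm with unit ball `𝒰` is the Minkowski
functional (gauge) of `𝒰`. -/
noncomputable def inducedNormValues {m n : ℕ} (B : Set (Fin m → ℝ)) (X : Set (Fin n → ℝ))
    (A : Matrix (Fin m) (Fin n) ℝ) : Set ℝ :=
  {r | ∃ x : Fin n → ℝ, gauge X x ≤ 1 ∧ r = gauge B (A *ᵥ x)}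

/-- The induced norm `‖A‖_{ℬ,𝒳} = max {‖A x‖_ℬ : ‖x‖_𝒳 ≤ 1}`. -/
noncomputable def inducedNorm {m n : ℕ} (B : Set (Fin m → ℝ)) (X : Set (Fin n → ℝ))
    (A : Matrix (Fin m) (Fin n) ℝ) : ℝ :=
  sSup (inducedNormValues B X A)

/-- The support function `φ_𝒯(l) = max_{t ∈ 𝒯} lᵀ t`. -/
noncomputable def supportFun {K : ℕ} (𝒯 : Set (Fin K → ℝ)) (l : Fin K → ℝ) : ℝ :=
  sSup {r | ∃ t ∈ 𝒯, r = l ⬝ᵥ t}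

/-- The values of the objective `φ_𝒯(l) + φ_𝒮(u)` of the semidefinite relaxation over its feasible
set: `l ≥ 0`, `u ≥ 0` and the block matrix
`[∑ u_ℓ S_ℓ, (1/2) Qᵀ A P; (1/2) Pᵀ Aᵀ Q, ∑ l_k T_k]` is positive semidefinite. -/
noncomputable def relaxationValues {m n p q K L : ℕ}
    (P : Matrix (Fin n) (Fin p) ℝ) (T : Fin K → Matrix (Fin p) (Fin p) ℝ) (𝒯 : Set (Fin K → ℝ))
    (Q : Matrix (Fin m) (Fin q) ℝ) (S : Fin L → Matrix (Fin q) (Fin q) ℝ) (𝒮 : Set (Fin L → ℝ))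
    (A : Matrix (Fin m) (Fin n) ℝ) : Set ℝ :=
  {r | ∃ (l : Fin K → ℝ) (u : Fin L → ℝ), 0 ≤ l ∧ 0 ≤ u ∧
    (Matrix.fromBlocks (∑ j, u j • S j) ((1 / 2 : ℝ) • (Qᵀ * A * P))
      ((1 / 2 : ℝ) • (Pᵀ * Aᵀ * Q)) (∑ k, l k • T k)).PosSemidef ∧
    r = supportFun 𝒯 l + supportFun 𝒮 u}

/-- The optimal value `Opt(A)` of the semidefinite relaxation. -/
noncomputable def relaxationOpt {m n p q K L : ℕ}
    (P : Matrix (Fin n) (Fin p) ℝ) (T : Fin K → Matrix (Fin p) (Fin p) ℝ) (𝒯 : Set (Fin K → ℝ))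
    (Q : Matrix (Fin m) (Fin q) ℝ) (S : Fin L → Matrix (Fin q) (Fin q) ℝ) (𝒮 : Set (Fin L → ℝ))
    (A : Matrix (Fin m) (Fin n) ℝ) : ℝ :=
  sInf (relaxationValues P T 𝒯 Q S 𝒮 A)

/-- The tightness factor `ς(K, L)`. -/
noncomputable def tightnessFactor (K L : ℕ) : ℝ :=
  if 1 < max K L then 3 * √(Real.log (4 * K) * Real.log (4 * L)) else 1

end EllitopicNorm

/-!
Both quantities are expressed through the bilinear form `zᵀ M w`, `M = Qᵀ A P`. The gauge of the
polar of `B_*` is the support function of `B_*` (`gauge_polar`), so the induced norm `N` is the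
maximum of `zᵀ M w` over the two basic ellitopes. A feasible `(l, u)` of the relaxation is one
for which `∑ u_j zᵀ S_j z + ∑ l_k wᵀ T_k w + zᵀ M w ≥ 0` for all `z`, `w`; inserting `-z` gives
the lower bound `N ≤ Opt(A)` (`bilin_le_of_feasible`).

For the upper bound, feasible multipliers of value at most `ρ = ς(K, L) N` are needed, that is, a
solution of an infinite system of affine inequalities on a compact convex set of multipliers. By
minimax (`exists_forall_nonneg_of_convexCombination`) it suffices to satisfy one convex
combination of the inequalities at a time. Such a combination is given by matrices `Z`, `W` with
columns `√μ_i z_i`, `√μ_i w_i`; it involves only the traces of `Wᵀ T_k W`, `Zᵀ S_j Z` and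
`Zᵀ M W`. By the bipolar theorem (`exists_dualBall_eq_smul`) there are multipliers, with support
functions at most one, at which the vectors of traces pair to `α`, `β`, where the traces of
`Wᵀ T_k W` are `α t_k` with `t ∈ 𝒯` and those of `Zᵀ S_j Z` are `β s_j` with `s ∈ 𝒮`. Scaled to
size `ρ / 2` they work as soon as `|tr (Zᵀ M W)| ≤ ρ √α √β`, by the inequality of arithmetic and
geometric means.

This last bound (`trace_le_of_trace_le`) is a rounding statement. If `Zᵀ M W = U diag(σ) Vᵀ` is a
singular value decomposition and `x` is any vector of signs, the vectors `z = Z U x`, `w = W V x`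
satisfy `zᵀ M w = ∑ σ_i ≥ tr (Zᵀ M W)`. For uniformly random signs the forms `wᵀ T_k w`,
`zᵀ S_j z` have the traces as means, and `exp` of a third of the normalized form has mean at most
`√3` (`sum_exp_quadForm_signValue_le`). Hence for some signs all forms exceed their means by
factors of at most `3 log (4 K)`, `3 log (4 L)` (`exists_signs_quadForm_le`), and homogeneity
gives the bound. For `K = L = 1` the Cauchy-Schwarz inequality gives it with constant `1`.
-/

namespace EllitopicNorm

/-! ### Quadratic forms of random signs -/

/-- The real number `±1` encoded by a Boolean. -/
def signValue (b : Bool) : ℝ := if b then 1 else -1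

lemma sum_exp_signValue_le {ι : Type*} [Fintype ι] [DecidableEq ι] (r : ι → ℝ) :
    ∑ e : ι → Bool, Real.exp (∑ i, signValue (e i) * r i) ≤
      2 ^ Fintype.card ι * Real.exp ((∑ i, r i ^ 2) / 2) := by
  have h : ∑ e : ι → Bool, Real.exp (∑ i, signValue (e i) * r i) =
      ∏ i, (2 * Real.cosh (r i)) := by
    simp_rw [Real.exp_sum]
    rw [← Fintype.prod_sum (fun i b => Real.exp (signValue b * r i))]
    refine Finset.prod_congr rfl fun i _ => ?_
    simp [signValue, Real.cosh_eq]
    ring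
  rw [h, Finset.prod_mul_distrib, Finset.prod_const, Finset.card_univ, Finset.sum_div,
    Real.exp_sum]
  gcongr with i
  exact Real.cosh_le_exp_half_sq _

lemma integrable_and_integral_exp_mul_sub_half_sq (c : ℝ) :
    MeasureTheory.Integrable (fun g : ℝ => Real.exp (c * g - g ^ 2 / 2)) ∧
      ∫ g : ℝ, Real.exp (c * g - g ^ 2 / 2) = √(2 * Real.pi) * Real.exp (c ^ 2 / 2) := by
  have h : (fun g : ℝ => Real.exp (c * g - g ^ 2 / 2)) =
      fun g => Real.exp (c ^ 2 / 2) * Real.exp (-(1 / 2) * (g - c) ^ 2) := by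
    funext g
    rw [← Real.exp_add]
    congr 1
    ring
  rw [h]
  constructor
  · exact ((integrable_exp_neg_mul_sq (by norm_num : (0 : ℝ) < 1 / 2)).comp_sub_right c).const_mul _
  · rw [MeasureTheory.integral_const_mul,
      MeasureTheory.integral_sub_right_eq_self (fun g : ℝ => Real.exp (-(1 / 2) * g ^ 2)) c,
      integral_gaussian, mul_comm]
    congr 2
    ring

/-- The square of a normalized Rademacher sum has exponential moment of order `1/3` at most `√3`,
its value for a standard Gaussian variable. -/
lemma sum_exp_sq_signValue_le {ι : Type*} [Fintype ι] [DecidableEq ι] (r : ι → ℝ)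
    (hr : ∑ i, r i ^ 2 ≤ 1) :
    ∑ e : ι → Bool, Real.exp ((∑ i, signValue (e i) * r i) ^ 2 / 3) ≤
      2 ^ Fintype.card ι * √3 := by
  set θ : ℝ := √(2 / 3)
  have hθ2 : θ ^ 2 = 2 / 3 := Real.sq_sqrt (by norm_num)
  have hpi : 0 < √(2 * Real.pi) := Real.sqrt_pos.2 (by positivity)
  refine le_of_mul_le_mul_left ?_ hpi
  -- `exp (x² / 3)` is the Gaussian average of `exp (θ x g)`, which linearizes the square.
  have h1 : ∀ e : ι → Bool, √(2 * Real.pi) * Real.exp ((∑ i, signValue (e i) * r i) ^ 2 / 3) =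
      ∫ g : ℝ, Real.exp (θ * (∑ i, signValue (e i) * r i) * g - g ^ 2 / 2) := by
    intro e
    rw [(integrable_and_integral_exp_mul_sub_half_sq _).2, mul_pow, hθ2]
    congr 2
    ring
  have hint : MeasureTheory.Integrable (fun g : ℝ => Real.exp (-(1 / 6) * g ^ 2)) :=
    integrable_exp_neg_mul_sq (by norm_num)
  rw [Finset.mul_sum]
  simp_rw [h1]
  rw [← MeasureTheory.integral_finsetSum _
    fun e _ => (integrable_and_integral_exp_mul_sub_half_sq _).1]
  calc ∫ g : ℝ, ∑ e : ι → Bool, Real.exp (θ * (∑ i, signValue (e i) * r i) * g - g ^ 2 / 2)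
      ≤ ∫ g : ℝ, 2 ^ Fintype.card ι * Real.exp (-(1 / 6) * g ^ 2) := by
        refine MeasureTheory.integral_mono
          (MeasureTheory.integrable_finsetSum _ fun e _ =>
            (integrable_and_integral_exp_mul_sub_half_sq _).1) (hint.const_mul _) fun g => ?_
        have h2 := sum_exp_signValue_le (fun i => θ * g * r i)
        have h3 : ∀ e : ι → Bool, Real.exp (θ * (∑ i, signValue (e i) * r i) * g - g ^ 2 / 2) =
            Real.exp (∑ i, signValue (e i) * (θ * g * r i)) * Real.exp (-(g ^ 2 / 2)) := by
          intro e
          rw [← Real.exp_add]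
          congr 1
          rw [sub_eq_add_neg, Finset.mul_sum, Finset.sum_mul]
          congr 1
          exact Finset.sum_congr rfl fun i _ => by ring
        simp only [h3]
        rw [← Finset.sum_mul]
        refine (mul_le_mul_of_nonneg_right h2 (Real.exp_pos _).le).trans ?_
        rw [mul_assoc, ← Real.exp_add]
        gcongr
        have h4 : ∑ i, (θ * g * r i) ^ 2 = 2 / 3 * g ^ 2 * ∑ i, r i ^ 2 := by
          rw [Finset.mul_sum]
          exact Finset.sum_congr rfl fun i _ => by rw [mul_pow, mul_pow, hθ2]
        rw [h4]
        nlinarith [mul_le_mul_of_nonneg_left hr (sq_nonneg g)]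
    _ = √(2 * Real.pi) * (2 ^ Fintype.card ι * √3) := by
        rw [MeasureTheory.integral_const_mul, integral_gaussian,
          show Real.pi / (1 / 6) = 2 * Real.pi * 3 by ring, Real.sqrt_mul (by positivity)]
        ring

/-- By convexity of `exp`, the bound for squares of Rademacher sums extends to the form of a
positive semidefinite matrix, normalized by its trace. If the trace vanishes, the quotient is the
junk value `0`, and the bound still holds. -/
lemma sum_exp_quadForm_signValue_le {ι : Type*} [Fintype ι] [DecidableEq ι] {R : Matrix ι ι ℝ}
    (hR : R.PosSemidef) :
    ∑ e : ι → Bool, Real.exp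
      ((fun i => signValue (e i)) ⬝ᵥ R *ᵥ (fun i => signValue (e i)) / (3 * R.trace)) ≤
      2 ^ Fintype.card ι * √3 := by
  obtain ⟨m, v, rfl⟩ := Matrix.posSemidef_iff_eq_sum_vecMulVec.1 hR
  have hq : ∀ x : ι → ℝ, x ⬝ᵥ (∑ j, Matrix.vecMulVec (v j) (star (v j))) *ᵥ x =
      ∑ j, (∑ i, x i * v j i) ^ 2 := by
    intro x
    rw [Matrix.sum_mulVec, dotProduct_sum]
    refine Finset.sum_congr rfl fun j _ => ?_
    rw [Matrix.vecMulVec_mulVec]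
    simp only [dotProduct, star_trivial, Pi.smul_apply, MulOpposite.smul_eq_mul_unop,
      MulOpposite.unop_op, sq, Finset.sum_mul, Finset.mul_sum]
    refine Finset.sum_congr rfl fun a _ => Finset.sum_congr rfl fun b _ => ?_
    ring
  have ht : (∑ j, Matrix.vecMulVec (v j) (star (v j))).trace = ∑ j, ∑ i, v j i ^ 2 := by
    rw [Matrix.trace_sum]
    refine Finset.sum_congr rfl fun j _ => ?_
    simp [Matrix.trace, Matrix.vecMulVec_apply, sq]
  simp only [hq, ht]
  set τ : ℝ := ∑ j, ∑ i, v j i ^ 2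
  have hn : ∀ j, 0 ≤ ∑ i, v j i ^ 2 := fun j => Finset.sum_nonneg fun i _ => sq_nonneg _
  have h3 : (1 : ℝ) ≤ √3 := Real.one_le_sqrt.2 (by norm_num)
  have hτ0 : 0 ≤ τ := Finset.sum_nonneg fun j _ => hn j
  rcases hτ0.eq_or_lt with h0 | hpos
  · simp only [← h0, mul_zero, div_zero, Real.exp_zero, Finset.sum_const, Finset.card_univ,
      nsmul_eq_mul, mul_one, Fintype.card_pi, Fintype.card_bool, Finset.prod_const]
    push_cast
    nlinarith [pow_pos (two_pos : (0 : ℝ) < 2) (Fintype.card ι)]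
  set w : Fin m → ℝ := fun j => (∑ i, v j i ^ 2) / τ with hw
  have hw0 : ∀ j, 0 ≤ w j := fun j => div_nonneg (hn j) hτ0
  have hw1 : ∑ j, w j = 1 := by rw [← Finset.sum_div, div_self hpos.ne']
  have key : ∀ e : ι → Bool, Real.exp ((∑ j, (∑ i, signValue (e i) * v j i) ^ 2) / (3 * τ)) ≤
      ∑ j, w j * Real.exp ((∑ i, signValue (e i) * (v j i / √(∑ i, v j i ^ 2))) ^ 2 / 3) := by
    intro e
    have hJ := convexOn_exp.map_sum_le (t := Finset.univ) (w := w)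
      (p := fun j => (∑ i, signValue (e i) * (v j i / √(∑ i, v j i ^ 2))) ^ 2 / 3)
      (fun j _ => hw0 j) hw1 (fun j _ => Set.mem_univ _)
    simp only [smul_eq_mul] at hJ
    refine le_of_eq_of_le ?_ hJ
    congr 1
    rw [Finset.sum_div]
    refine Finset.sum_congr rfl fun j _ => ?_
    have h5 : ∑ i, signValue (e i) * (v j i / √(∑ i, v j i ^ 2)) =
        (∑ i, signValue (e i) * v j i) / √(∑ i, v j i ^ 2) := by
      rw [Finset.sum_div]
      exact Finset.sum_congr rfl fun i _ => by ring
    rw [h5, div_pow, Real.sq_sqrt (hn j)]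
    rcases (hn j).eq_or_lt with h6 | h6
    · have h7 : ∀ i, v j i = 0 := fun i => by
        have := (Finset.sum_eq_zero_iff_of_nonneg fun i _ => sq_nonneg (v j i)).1 h6.symm i
          (Finset.mem_univ i)
        simpa using this
      simp [h7]
    · simp only [hw]
      field_simp
  calc _ ≤ ∑ e : ι → Bool, ∑ j,
        w j * Real.exp ((∑ i, signValue (e i) * (v j i / √(∑ i, v j i ^ 2))) ^ 2 / 3) :=
        Finset.sum_le_sum fun e _ => key e
    _ = ∑ j, w j * ∑ e : ι → Bool,
        Real.exp ((∑ i, signValue (e i) * (v j i / √(∑ i, v j i ^ 2))) ^ 2 / 3) := by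
        rw [Finset.sum_comm]
        simp_rw [Finset.mul_sum]
    _ ≤ ∑ j, w j * (2 ^ Fintype.card ι * √3) := by
        refine Finset.sum_le_sum fun j _ => mul_le_mul_of_nonneg_left ?_ (hw0 j)
        refine sum_exp_sq_signValue_le _ ?_
        simp_rw [div_pow, Real.sq_sqrt (hn j)]
        rw [← Finset.sum_div]
        exact div_self_le_one _
    _ = 2 ^ Fintype.card ι * √3 := by rw [← Finset.sum_mul, hw1, one_mul]

/-- Union bound: some sign vector satisfies all `K + L` quadratic inequalities at once. The failure
probabilities add up to at most `√3 / 4 + √3 / 4 < 1`. -/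
lemma exists_signs_quadForm_le {ι : Type*} [Fintype ι] [DecidableEq ι] {K L : ℕ}
    (hK : 0 < K) (hL : 0 < L)
    {F : Fin K → Matrix ι ι ℝ} {G : Fin L → Matrix ι ι ℝ}
    (hF : ∀ k, (F k).PosSemidef) (hG : ∀ l, (G l).PosSemidef) :
    ∃ x : ι → ℝ, (∀ i, x i ^ 2 = 1) ∧
      (∀ k, x ⬝ᵥ F k *ᵥ x ≤ 3 * Real.log (4 * K) * (F k).trace) ∧
      (∀ l, x ⬝ᵥ G l *ᵥ x ≤ 3 * Real.log (4 * L) * (G l).trace) := by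
  let s : (ι → Bool) → ι → ℝ := fun e i => signValue (e i)
  let f : (ι → Bool) → Fin K → ℝ := fun e k => Real.exp (s e ⬝ᵥ F k *ᵥ s e / (3 * (F k).trace))
  let g : (ι → Bool) → Fin L → ℝ := fun e l => Real.exp (s e ⬝ᵥ G l *ᵥ s e / (3 * (G l).trace))
  have hK' : (0 : ℝ) < K := by exact_mod_cast hK
  have hL' : (0 : ℝ) < L := by exact_mod_cast hL
  have h3 : √3 < 2 := by
    rw [Real.sqrt_lt' two_pos]
    norm_num
  have h2 : (0 : ℝ) < 2 ^ Fintype.card ι := by positivity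
  have hsum : ∑ e, ((∑ k, f e k) / (4 * K) + (∑ l, g e l) / (4 * L)) <
      ∑ _e : ι → Bool, (1 : ℝ) := by
    have h4 : ∑ e, ∑ k, f e k ≤ K * (2 ^ Fintype.card ι * √3) := by
      rw [Finset.sum_comm]
      refine (Finset.sum_le_sum fun k _ => sum_exp_quadForm_signValue_le (hF k)).trans ?_
      simp
    have h5 : ∑ e, ∑ l, g e l ≤ L * (2 ^ Fintype.card ι * √3) := by
      rw [Finset.sum_comm]
      refine (Finset.sum_le_sum fun l _ => sum_exp_quadForm_signValue_le (hG l)).trans ?_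
      simp
    rw [Finset.sum_add_distrib, ← Finset.sum_div, ← Finset.sum_div]
    calc _ ≤ K * (2 ^ Fintype.card ι * √3) / (4 * K) + L * (2 ^ Fintype.card ι * √3) / (4 * L) := by
          gcongr
      _ = 2 ^ Fintype.card ι * √3 / 2 := by field_simp; norm_num
      _ < 2 ^ Fintype.card ι := by nlinarith
      _ = ∑ _e : ι → Bool, (1 : ℝ) := by simp
  obtain ⟨e, -, he⟩ := Finset.exists_lt_of_sum_lt hsum
  have hf0 : ∀ k, 0 < f e k := fun k => Real.exp_pos _
  have hg0 : ∀ l, 0 < g e l := fun l => Real.exp_pos _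
  have hfs : 0 ≤ (∑ k, f e k) / (4 * K) :=
    div_nonneg (Finset.sum_nonneg fun k _ => (hf0 k).le) (by positivity)
  have hgs : 0 ≤ (∑ l, g e l) / (4 * L) :=
    div_nonneg (Finset.sum_nonneg fun l _ => (hg0 l).le) (by positivity)
  -- From a bound on the exponential to a bound on the form; a form of trace `0` vanishes.
  have fin : ∀ (R : Matrix ι ι ℝ), R.PosSemidef → ∀ c : ℝ, 0 < c →
      Real.exp (s e ⬝ᵥ R *ᵥ s e / (3 * R.trace)) < c →
      s e ⬝ᵥ R *ᵥ s e ≤ 3 * Real.log c * R.trace := by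
    intro R hR c hc h
    rcases hR.trace_nonneg.eq_or_lt with h0 | hpos
    · have : R = 0 := hR.trace_eq_zero_iff.1 h0.symm
      simp [this]
    · rw [← Real.lt_log_iff_exp_lt hc, div_lt_iff₀ (by positivity)] at h
      linarith
  refine ⟨s e, fun i => ?_, fun k => fin _ (hF k) _ (by positivity) ?_,
    fun l => fin _ (hG l) _ (by positivity) ?_⟩
  · simp only [s, signValue]
    split_ifs <;> norm_num
  · have h6 : f e k ≤ ∑ k, f e k :=
      Finset.single_le_sum (f := f e) (fun k _ => (hf0 k).le) (Finset.mem_univ k)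
    have h7 : (∑ k, f e k) / (4 * K) < 1 := by linarith
    rw [div_lt_one (by positivity)] at h7
    exact h6.trans_lt h7
  · have h6 : g e l ≤ ∑ l, g e l :=
      Finset.single_le_sum (f := g e) (fun l _ => (hg0 l).le) (Finset.mem_univ l)
    have h7 : (∑ l, g e l) / (4 * L) < 1 := by linarith
    rw [div_lt_one (by positivity)] at h7
    exact h6.trans_lt h7

/-! ### Singular value decomposition of a square matrix -/

/-- Singular value decomposition of a real square matrix, together with the fact that the trace is
at most the nuclear norm `∑ i, σ i`. The left singular vectors are the normalized images of the
eigenvectors of `Fᵀ F` with nonzero eigenvalue, completed to an orthonormal basis. -/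
lemma exists_singularValueDecomposition {ι : Type*} [Fintype ι] [DecidableEq ι]
    (F : Matrix ι ι ℝ) :
    ∃ (U V : Matrix ι ι ℝ) (σ : ι → ℝ), U * Uᵀ = 1 ∧ V * Vᵀ = 1 ∧ (∀ i, 0 ≤ σ i) ∧
      Uᵀ * F * V = Matrix.diagonal σ ∧ F.trace ≤ ∑ i, σ i := by
  have hps : (Fᵀ * F).PosSemidef := by
    simpa using Matrix.posSemidef_conjTranspose_mul_self F
  set ψ := hps.isHermitian.eigenvectorBasis
  set μ := hps.isHermitian.eigenvalues
  have hμ0 : ∀ i, 0 ≤ μ i := hps.eigenvalues_nonneg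
  have hev : ∀ j, (Fᵀ * F) *ᵥ (ψ j).ofLp = μ j • (ψ j).ofLp :=
    fun j => hps.isHermitian.mulVec_eigenvectorBasis j
  have hortho : ∀ (b : OrthonormalBasis ι ℝ (EuclideanSpace ℝ ι)) (i j : ι),
      (b i).ofLp ⬝ᵥ (b j).ofLp = if i = j then 1 else 0 := by
    intro b i j
    have := orthonormal_iff_ite.1 b.orthonormal j i
    rw [EuclideanSpace.inner_eq_star_dotProduct] at this
    simpa [eq_comm] using this
  have hgram : ∀ i j, (F *ᵥ (ψ i).ofLp) ⬝ᵥ (F *ᵥ (ψ j).ofLp) = if i = j then μ j else 0 := by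
    intro i j
    have h1 : (F *ᵥ (ψ i).ofLp) ⬝ᵥ (F *ᵥ (ψ j).ofLp) =
        (ψ i).ofLp ⬝ᵥ ((Fᵀ * F) *ᵥ (ψ j).ofLp) := by
      rw [← Matrix.mulVec_mulVec, Matrix.dotProduct_mulVec (ψ i).ofLp, Matrix.vecMul_transpose]
    rw [h1, hev, dotProduct_smul, hortho]
    simp
  let v : ι → EuclideanSpace ℝ ι := fun i => WithLp.toLp 2 ((√(μ i))⁻¹ • (F *ᵥ (ψ i).ofLp))
  have hv : Orthonormal ℝ (Set.domRestrict {i | μ i ≠ 0} v) := by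
    rw [orthonormal_iff_ite]
    rintro ⟨i, hi⟩ ⟨j, hj⟩
    have hi' : μ i ≠ 0 := hi
    have hs : √(μ i) * √(μ i) = μ i := Real.mul_self_sqrt (hμ0 i)
    have hs0 : √(μ i) ≠ 0 := fun h => hi' (by rw [← hs, h, zero_mul])
    simp only [Set.domRestrict_apply, EuclideanSpace.inner_eq_star_dotProduct, v, star_trivial,
      dotProduct_smul, smul_dotProduct, hgram, Subtype.mk.injEq, smul_eq_mul]
    by_cases hij : i = j
    · subst hij
      simp only [if_true]
      rw [← mul_assoc, ← mul_inv, hs, inv_mul_cancel₀ hi']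
    · simp [hij, Ne.symm hij]
  obtain ⟨b, hb⟩ := hv.exists_orthonormalBasis_extension_of_card_eq (by simp)
  have hFψ : ∀ i, F *ᵥ (ψ i).ofLp = √(μ i) • (b i).ofLp := by
    intro i
    by_cases h0 : μ i = 0
    · have h1 := hgram i i
      rw [if_pos rfl, h0, dotProduct_self_eq_zero] at h1
      simp [h1, h0]
    · have hs0 : √(μ i) ≠ 0 := (Real.sqrt_pos.2 ((hμ0 i).lt_of_ne' h0)).ne'
      rw [hb i h0]
      simp [v, smul_smul, hs0]
  have hU : ∀ c : OrthonormalBasis ι ℝ (EuclideanSpace ℝ ι),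
      (Matrix.of fun a i => (c i).ofLp a)ᵀ * (Matrix.of fun a i => (c i).ofLp a) = 1 := by
    intro c
    ext i j
    rw [Matrix.mul_apply, Matrix.one_apply, ← hortho c i j]
    rfl
  set U : Matrix ι ι ℝ := Matrix.of fun a i => (b i).ofLp a with hUdef
  set V : Matrix ι ι ℝ := Matrix.of fun a i => (ψ i).ofLp a
  have hUU : U * Uᵀ = 1 := mul_eq_one_comm.1 (hU b)
  have hVV : V * Vᵀ = 1 := mul_eq_one_comm.1 (hU ψ)
  have hFV : F * V = U * Matrix.diagonal fun i => √(μ i) := by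
    ext a i
    rw [Matrix.mul_diagonal]
    have := congrFun (hFψ i) a
    simp only [Pi.smul_apply, smul_eq_mul] at this
    rw [hUdef, Matrix.of_apply, mul_comm, ← this]
    rfl
  refine ⟨U, V, fun i => √(μ i), hUU, hVV, fun i => Real.sqrt_nonneg _, ?_, ?_⟩
  · rw [Matrix.mul_assoc, hFV, ← Matrix.mul_assoc, hU b, Matrix.one_mul]
  · have hF : F = U * (Matrix.diagonal fun i => √(μ i)) * Vᵀ := by
      rw [← hFV, Matrix.mul_assoc, hVV, Matrix.mul_one]
    have htr : F.trace = ∑ i, √(μ i) * ((ψ i).ofLp ⬝ᵥ (b i).ofLp) := by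
      conv_lhs => rw [hF]
      rw [Matrix.mul_assoc, Matrix.trace_mul_comm, Matrix.mul_assoc]
      simp only [Matrix.trace, Matrix.diag_apply, Matrix.diagonal_mul]
      rfl
    rw [htr]
    refine Finset.sum_le_sum fun i _ => ?_
    refine mul_le_of_le_one_right (Real.sqrt_nonneg _) ?_
    have h1 := real_inner_le_norm (b i) (ψ i)
    rw [EuclideanSpace.inner_eq_star_dotProduct, b.orthonormal.1, ψ.orthonormal.1] at h1
    simpa using h1

/-! ### Rounding a matrix solution to a vector solution -/

section Rounding

variable {p q K L : ℕ} {T : Fin K → Matrix (Fin p) (Fin p) ℝ} {𝒯 : Set (Fin K → ℝ)}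
  {S : Fin L → Matrix (Fin q) (Fin q) ℝ} {𝒮 : Set (Fin L → ℝ)}

lemma quadForm_nonneg {ι : Type*} [Fintype ι] {R : Matrix ι ι ℝ} (hR : R.PosSemidef) (w : ι → ℝ) :
    0 ≤ w ⬝ᵥ R *ᵥ w := by
  simpa using hR.dotProduct_mulVec_nonneg w

lemma quadForm_smul {ι : Type*} [Fintype ι] (R : Matrix ι ι ℝ) (c : ℝ) (w : ι → ℝ) :
    (c • w) ⬝ᵥ R *ᵥ (c • w) = c ^ 2 * (w ⬝ᵥ R *ᵥ w) := by
  rw [Matrix.mulVec_smul, smul_dotProduct, dotProduct_smul, smul_eq_mul, smul_eq_mul]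
  ring

lemma IsBasicEllitopeData.nonempty (hT : IsBasicEllitopeData T 𝒯) : 𝒯.Nonempty :=
  hT.interior_nonempty.mono interior_subset

lemma IsBasicEllitopeData.sum_quadForm_pos (hT : IsBasicEllitopeData T 𝒯) {w : Fin p → ℝ}
    (hw : w ≠ 0) : 0 < ∑ k, w ⬝ᵥ T k *ᵥ w := by
  have h := hT.posDef_sum.dotProduct_mulVec_pos hw
  rwa [star_trivial, Matrix.sum_mulVec, dotProduct_sum] at h

lemma IsBasicEllitopeData.eq_zero_of_quadForm_nonpos (hT : IsBasicEllitopeData T 𝒯)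
    {w : Fin p → ℝ} (hw : ∀ k, w ⬝ᵥ T k *ᵥ w ≤ 0) : w = 0 := by
  by_contra h
  exact (hT.sum_quadForm_pos h).not_ge (Finset.sum_nonpos fun k _ => hw k)

lemma IsBasicEllitopeData.zero_mem_basicEllitope (hT : IsBasicEllitopeData T 𝒯) :
    (0 : Fin p → ℝ) ∈ basicEllitope T 𝒯 := by
  obtain ⟨t, ht⟩ := hT.nonempty
  exact ⟨t, ht, fun k => by simpa using hT.nonneg t ht k⟩

/-- Homogeneity: a vector whose forms are at most `α t` is `√α` times a point of the basic ellitope.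
Positive definiteness of the sum is what covers `α = 0`. -/
lemma IsBasicEllitopeData.exists_eq_sqrt_smul (hT : IsBasicEllitopeData T 𝒯) {w : Fin p → ℝ}
    {t : Fin K → ℝ} (ht : t ∈ 𝒯) {α : ℝ} (hα : 0 ≤ α) (hw : ∀ k, w ⬝ᵥ T k *ᵥ w ≤ α * t k) :
    ∃ w₀ ∈ basicEllitope T 𝒯, w = √α • w₀ := by
  rcases hα.eq_or_lt with rfl | hpos
  · exact ⟨0, hT.zero_mem_basicEllitope, by
      simpa using hT.eq_zero_of_quadForm_nonpos fun k => by simpa using hw k⟩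
  · have hs : √α ≠ 0 := (Real.sqrt_pos.2 hpos).ne'
    refine ⟨(√α)⁻¹ • w, ⟨t, ht, fun k => ?_⟩, by rw [smul_smul, mul_inv_cancel₀ hs, one_smul]⟩
    rw [quadForm_smul, inv_pow, Real.sq_sqrt hα, inv_mul_le_iff₀ hpos]
    exact hw k

lemma bilin_le_of_quadForm_le (hT : IsBasicEllitopeData T 𝒯) (hS : IsBasicEllitopeData S 𝒮)
    {M : Matrix (Fin q) (Fin p) ℝ} {N : ℝ}
    (hN : ∀ z ∈ basicEllitope S 𝒮, ∀ w ∈ basicEllitope T 𝒯, z ⬝ᵥ M *ᵥ w ≤ N)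
    {w : Fin p → ℝ} {z : Fin q → ℝ} {t : Fin K → ℝ} (ht : t ∈ 𝒯) {s : Fin L → ℝ} (hs : s ∈ 𝒮)
    {α β : ℝ} (hα : 0 ≤ α) (hβ : 0 ≤ β)
    (hw : ∀ k, w ⬝ᵥ T k *ᵥ w ≤ α * t k) (hz : ∀ l, z ⬝ᵥ S l *ᵥ z ≤ β * s l) :
    z ⬝ᵥ M *ᵥ w ≤ √α * √β * N := by
  obtain ⟨w₀, hw₀, rfl⟩ := hT.exists_eq_sqrt_smul ht hα hw
  obtain ⟨z₀, hz₀, rfl⟩ := hS.exists_eq_sqrt_smul hs hβ hz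
  rw [Matrix.mulVec_smul, smul_dotProduct, dotProduct_smul, smul_eq_mul, smul_eq_mul, ← mul_assoc,
    mul_comm (√β)]
  exact mul_le_mul_of_nonneg_left (hN z₀ hz₀ w₀ hw₀) (by positivity)

lemma nonneg_of_bilin_le (hT : IsBasicEllitopeData T 𝒯) (hS : IsBasicEllitopeData S 𝒮)
    {M : Matrix (Fin q) (Fin p) ℝ} {N : ℝ}
    (hN : ∀ z ∈ basicEllitope S 𝒮, ∀ w ∈ basicEllitope T 𝒯, z ⬝ᵥ M *ᵥ w ≤ N) : 0 ≤ N := by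
  simpa using hN 0 hS.zero_mem_basicEllitope 0 hT.zero_mem_basicEllitope

lemma trace_conj_eq_sum {ι : Type*} [Fintype ι] (Z : Matrix (Fin q) ι ℝ)
    (M : Matrix (Fin q) (Fin p) ℝ) (W : Matrix (Fin p) ι ℝ) :
    (Zᵀ * M * W).trace = ∑ i, Z.col i ⬝ᵥ M *ᵥ W.col i := by
  refine Finset.sum_congr rfl fun i _ => ?_
  rw [Matrix.mul_assoc, Matrix.diag_apply, Matrix.mul_apply]
  rfl

lemma tightnessFactor_nonneg (K L : ℕ) : 0 ≤ tightnessFactor K L := by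
  unfold tightnessFactor
  split_ifs <;> positivity

/-- Randomized rounding. After multiplication by the singular vectors of `Zᵀ M W`, every sign
combination `x` of the columns has `xᵀ Zᵀ M W x = ‖Zᵀ M W‖_nuc ≥ tr (Zᵀ M W)`, with no randomness
left, while the forms of `T` and `S` are controlled by their traces for some `x`. -/
lemma trace_le_of_trace_le_of_pos (hT : IsBasicEllitopeData T 𝒯) (hS : IsBasicEllitopeData S 𝒮)
    (hK : 0 < K) (hL : 0 < L) {M : Matrix (Fin q) (Fin p) ℝ} {N : ℝ}
    (hN : ∀ z ∈ basicEllitope S 𝒮, ∀ w ∈ basicEllitope T 𝒯, z ⬝ᵥ M *ᵥ w ≤ N)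
    {ι : Type*} [Fintype ι] {Z : Matrix (Fin q) ι ℝ} {W : Matrix (Fin p) ι ℝ}
    {t : Fin K → ℝ} (ht : t ∈ 𝒯) {s : Fin L → ℝ} (hs : s ∈ 𝒮) {α β : ℝ} (hα : 0 ≤ α) (hβ : 0 ≤ β)
    (hW : ∀ k, (Wᵀ * T k * W).trace ≤ α * t k) (hZ : ∀ l, (Zᵀ * S l * Z).trace ≤ β * s l) :
    (Zᵀ * M * W).trace ≤ 3 * √(Real.log (4 * K) * Real.log (4 * L)) * (√α * √β * N) := by
  classical
  obtain ⟨U, V, σ, hU, hV, -, hd, htr⟩ := exists_singularValueDecomposition (Zᵀ * M * W)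
  have hlog : ∀ {J : ℕ}, 0 < J → 0 ≤ Real.log (4 * J) := fun {J} hJ => Real.log_nonneg (by
    have : (1 : ℝ) ≤ J := by exact_mod_cast hJ
    linarith)
  have hform : ∀ {r r' : ℕ} (X : Matrix (Fin r) ι ℝ) (O O' : Matrix ι ι ℝ)
      (R : Matrix (Fin r) (Fin r') ℝ) (Y : Matrix (Fin r') ι ℝ) (x : ι → ℝ),
      ((X * O) *ᵥ x) ⬝ᵥ R *ᵥ ((Y * O') *ᵥ x) = x ⬝ᵥ (Oᵀ * (Xᵀ * R * Y) * O') *ᵥ x := by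
    intro r r' X O O' R Y x
    have : Oᵀ * (Xᵀ * R * Y) * O' = (X * O)ᵀ * (R * (Y * O')) := by
      simp only [Matrix.transpose_mul, Matrix.mul_assoc]
    rw [this, ← Matrix.mulVec_mulVec x (X * O)ᵀ, Matrix.dotProduct_mulVec x,
      Matrix.vecMul_transpose, ← Matrix.mulVec_mulVec x R]
  have hps : ∀ {r : ℕ} (X : Matrix (Fin r) ι ℝ) (O : Matrix ι ι ℝ) {R : Matrix (Fin r) (Fin r) ℝ},
      R.PosSemidef → (Oᵀ * (Xᵀ * R * X) * O).PosSemidef := by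
    intro r X O R hR
    simpa using (hR.conjTranspose_mul_mul_same X).conjTranspose_mul_mul_same O
  have htrace : ∀ {O : Matrix ι ι ℝ} (R : Matrix ι ι ℝ), O * Oᵀ = 1 →
      (Oᵀ * R * O).trace = R.trace := by
    intro O R hO
    rw [Matrix.trace_mul_comm, ← Matrix.mul_assoc, hO, Matrix.one_mul]
  obtain ⟨x, hx1, hxT, hxS⟩ := exists_signs_quadForm_le hK hL
    (F := fun k => Vᵀ * (Wᵀ * T k * W) * V) (G := fun l => Uᵀ * (Zᵀ * S l * Z) * U)
    (fun k => hps W V (hT.posSemidef k)) (fun l => hps Z U (hS.posSemidef l))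
  have hσ : ((Z * U) *ᵥ x) ⬝ᵥ M *ᵥ ((W * V) *ᵥ x) = ∑ i, σ i := by
    rw [hform, hd]
    refine Finset.sum_congr rfl fun i _ => ?_
    rw [Matrix.mulVec_diagonal]
    linear_combination σ i * hx1 i
  have hb := bilin_le_of_quadForm_le hT hS hN ht hs
    (α := 3 * Real.log (4 * K) * α) (β := 3 * Real.log (4 * L) * β)
    (w := (W * V) *ᵥ x) (z := (Z * U) *ᵥ x)
    (mul_nonneg (mul_nonneg zero_le_three (hlog hK)) hα)
    (mul_nonneg (mul_nonneg zero_le_three (hlog hL)) hβ)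
    (fun k => by
      rw [hform]
      refine (hxT k).trans ?_
      rw [htrace _ hV, mul_assoc _ α]
      exact mul_le_mul_of_nonneg_left (hW k) (mul_nonneg zero_le_three (hlog hK)))
    (fun l => by
      rw [hform]
      refine (hxS l).trans ?_
      rw [htrace _ hU, mul_assoc _ β]
      exact mul_le_mul_of_nonneg_left (hZ l) (mul_nonneg zero_le_three (hlog hL)))
  rw [hσ] at hb
  refine htr.trans (hb.trans_eq ?_)
  rw [Real.sqrt_mul (mul_nonneg zero_le_three (hlog hK)),
    Real.sqrt_mul (mul_nonneg zero_le_three (hlog hL)), Real.sqrt_mul zero_le_three,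
    Real.sqrt_mul zero_le_three, Real.sqrt_mul (hlog hK)]
  linear_combination √(Real.log (4 * K)) * √(Real.log (4 * L)) * √α * √β * N *
    Real.mul_self_sqrt (zero_le_three (α := ℝ))

/-- For one quadratic form on each side no rounding is needed: the bound holds for each column, and
the Cauchy-Schwarz inequality adds the columns up. -/
lemma trace_le_of_trace_le_of_one {T : Fin 1 → Matrix (Fin p) (Fin p) ℝ} {𝒯 : Set (Fin 1 → ℝ)}
    {S : Fin 1 → Matrix (Fin q) (Fin q) ℝ} {𝒮 : Set (Fin 1 → ℝ)}
    (hT : IsBasicEllitopeData T 𝒯) (hS : IsBasicEllitopeData S 𝒮)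
    {M : Matrix (Fin q) (Fin p) ℝ} {N : ℝ}
    (hN : ∀ z ∈ basicEllitope S 𝒮, ∀ w ∈ basicEllitope T 𝒯, z ⬝ᵥ M *ᵥ w ≤ N)
    {ι : Type*} [Fintype ι] {Z : Matrix (Fin q) ι ℝ} {W : Matrix (Fin p) ι ℝ}
    {t : Fin 1 → ℝ} (ht : t ∈ 𝒯) {s : Fin 1 → ℝ} (hs : s ∈ 𝒮) {α β : ℝ} (hα : 0 ≤ α) (hβ : 0 ≤ β)
    (hW : ∀ k, (Wᵀ * T k * W).trace ≤ α * t k) (hZ : ∀ l, (Zᵀ * S l * Z).trace ≤ β * s l) :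
    (Zᵀ * M * W).trace ≤ √α * √β * N := by
  have hN0 := nonneg_of_bilin_le hT hS hN
  -- The scale of each column; for `t 0 = 0` the form vanishes on all columns, and so does the
  -- junk value of the quotient.
  have aux : ∀ {r : ℕ} {T : Fin 1 → Matrix (Fin r) (Fin r) ℝ} {𝒯 : Set (Fin 1 → ℝ)}
      (_ : IsBasicEllitopeData T 𝒯) {t : Fin 1 → ℝ} (_ : t ∈ 𝒯) {W : Matrix (Fin r) ι ℝ} {α : ℝ}
      (_ : 0 ≤ α) (_ : ∀ k, (Wᵀ * T k * W).trace ≤ α * t k),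
      ∃ a : ι → ℝ, (∀ i, 0 ≤ a i) ∧ (∀ i k, W.col i ⬝ᵥ T k *ᵥ W.col i ≤ a i * t k) ∧
        ∑ i, a i ≤ α := by
    intro r T 𝒯 hT t ht W α hα hW
    have h1 := hW 0
    rw [trace_conj_eq_sum] at h1
    have h2 : ∀ i, 0 ≤ W.col i ⬝ᵥ T 0 *ᵥ W.col i := fun i => quadForm_nonneg (hT.posSemidef 0) _
    refine ⟨fun i => (W.col i ⬝ᵥ T 0 *ᵥ W.col i) / t 0,
      fun i => div_nonneg (h2 i) (hT.nonneg t ht 0), fun i k => ?_, ?_⟩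
    · rw [Subsingleton.elim k 0]
      by_cases h0 : t 0 = 0
      · rw [h0, mul_zero] at h1
        have := Finset.single_le_sum (f := fun i => W.col i ⬝ᵥ T 0 *ᵥ W.col i)
          (fun i _ => h2 i) (Finset.mem_univ i)
        simp only [h0, mul_zero]
        exact this.trans h1
      · rw [div_mul_cancel₀ _ h0]
    · rw [← Finset.sum_div]
      exact div_le_of_le_mul₀ (hT.nonneg t ht 0) hα h1
  obtain ⟨a, ha0, ha, has⟩ := aux hT ht hα hW
  obtain ⟨b, hb0, hb, hbs⟩ := aux hS hs hβ hZ
  rw [trace_conj_eq_sum]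
  calc ∑ i, Z.col i ⬝ᵥ M *ᵥ W.col i ≤ ∑ i, √(a i) * √(b i) * N :=
        Finset.sum_le_sum fun i _ =>
          bilin_le_of_quadForm_le hT hS hN ht hs (ha0 i) (hb0 i) (ha i) (hb i)
    _ = (∑ i, √(a i) * √(b i)) * N := by rw [Finset.sum_mul]
    _ ≤ √α * √β * N := by
        refine mul_le_mul_of_nonneg_right ?_ hN0
        refine (Real.sum_sqrt_mul_sqrt_le _ ha0 hb0).trans ?_
        gcongr

/-- The duality gap on the primal side: a matrix solution given by its factors `Z`, `W` is at most
`tightnessFactor K L` times better than the best vector solution. -/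
lemma trace_le_of_trace_le (hT : IsBasicEllitopeData T 𝒯) (hS : IsBasicEllitopeData S 𝒮)
    {M : Matrix (Fin q) (Fin p) ℝ} {N : ℝ}
    (hN : ∀ z ∈ basicEllitope S 𝒮, ∀ w ∈ basicEllitope T 𝒯, z ⬝ᵥ M *ᵥ w ≤ N)
    {ι : Type*} [Fintype ι] {Z : Matrix (Fin q) ι ℝ} {W : Matrix (Fin p) ι ℝ}
    {t : Fin K → ℝ} (ht : t ∈ 𝒯) {s : Fin L → ℝ} (hs : s ∈ 𝒮) {α β : ℝ} (hα : 0 ≤ α) (hβ : 0 ≤ β)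
    (hW : ∀ k, (Wᵀ * T k * W).trace ≤ α * t k) (hZ : ∀ l, (Zᵀ * S l * Z).trace ≤ β * s l) :
    (Zᵀ * M * W).trace ≤ tightnessFactor K L * (√α * √β * N) := by
  have hN0 := nonneg_of_bilin_le hT hS hN
  have hr : 0 ≤ tightnessFactor K L * (√α * √β * N) :=
    mul_nonneg (tightnessFactor_nonneg K L) (by positivity)
  -- Without quadratic forms, positive definiteness of the empty sum leaves only the zero vector.
  rcases K.eq_zero_or_pos with rfl | hK
  · have h0 : ∀ w : Fin p → ℝ, w = 0 := fun w => hT.eq_zero_of_quadForm_nonpos fun k => k.elim0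
    rw [trace_conj_eq_sum]
    exact (Finset.sum_nonpos fun i _ => by rw [h0 (W.col i)]; simp).trans hr
  rcases L.eq_zero_or_pos with rfl | hL
  · have h0 : ∀ z : Fin q → ℝ, z = 0 := fun w => hS.eq_zero_of_quadForm_nonpos fun k => k.elim0
    rw [trace_conj_eq_sum]
    exact (Finset.sum_nonpos fun i _ => by rw [h0 (Z.col i)]; simp).trans hr
  unfold tightnessFactor
  split_ifs with h
  · exact trace_le_of_trace_le_of_pos hT hS hK hL hN ht hs hα hβ hW hZ
  · obtain rfl : K = 1 := by omega
    obtain rfl : L = 1 := by omega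
    rw [one_mul]
    exact trace_le_of_trace_le_of_one hT hS hN ht hs hα hβ hW hZ

end Rounding

/-! ### Support functions -/

section SupportFun

variable {p K : ℕ} {T : Fin K → Matrix (Fin p) (Fin p) ℝ} {𝒯 : Set (Fin K → ℝ)}

lemma supportFun_eq_sSup_image (𝒯 : Set (Fin K → ℝ)) (l : Fin K → ℝ) :
    supportFun 𝒯 l = sSup ((fun t => l ⬝ᵥ t) '' 𝒯) := by
  unfold supportFun
  congr 1
  ext r
  simp [eq_comm]

lemma continuous_supportFun (h𝒯 : IsCompact 𝒯) : Continuous (supportFun 𝒯) := by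
  have h : supportFun 𝒯 = fun l => sSup ((fun t => l ⬝ᵥ t) '' 𝒯) :=
    funext fun l => supportFun_eq_sSup_image 𝒯 l
  rw [h]
  refine h𝒯.continuous_sSup (f := fun l t => l ⬝ᵥ t) ?_
  exact Continuous.dotProduct continuous_fst continuous_snd

lemma dotProduct_le_supportFun (h𝒯 : IsCompact 𝒯) (l : Fin K → ℝ) {t : Fin K → ℝ} (ht : t ∈ 𝒯) :
    l ⬝ᵥ t ≤ supportFun 𝒯 l := by
  rw [supportFun_eq_sSup_image]
  refine le_csSup (h𝒯.bddAbove_image ?_) (Set.mem_image_of_mem _ ht)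
  exact (Continuous.dotProduct continuous_const continuous_id).continuousOn

lemma supportFun_le (h𝒯 : 𝒯.Nonempty) {l : Fin K → ℝ} {c : ℝ} (h : ∀ t ∈ 𝒯, l ⬝ᵥ t ≤ c) :
    supportFun 𝒯 l ≤ c := by
  rw [supportFun_eq_sSup_image]
  exact csSup_le (h𝒯.image _) (Set.forall_mem_image.2 h)

lemma supportFun_smul_le (hT : IsBasicEllitopeData T 𝒯) {c : ℝ} (hc : 0 ≤ c) (l : Fin K → ℝ) :
    supportFun 𝒯 (c • l) ≤ c * supportFun 𝒯 l := by
  refine supportFun_le hT.nonempty fun t ht => ?_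
  rw [smul_dotProduct, smul_eq_mul]
  exact mul_le_mul_of_nonneg_left (dotProduct_le_supportFun hT.isCompact l ht) hc

lemma IsBasicEllitopeData.exists_pos (hT : IsBasicEllitopeData T 𝒯) :
    ∃ t ∈ 𝒯, ∀ k, 0 < t k := by
  obtain ⟨t, ht⟩ := hT.interior_nonempty
  obtain ⟨δ, hδ, hball⟩ := Metric.mem_nhds_iff.1 (mem_interior_iff_mem_nhds.1 ht)
  refine ⟨t, interior_subset ht, fun k => ?_⟩
  have h1 : t - (fun _ => δ / 2) ∈ 𝒯 := by
    refine hball ?_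
    rw [Metric.mem_ball, dist_eq_norm, sub_sub_cancel_left, norm_neg]
    refine (pi_norm_const_le (δ / 2)).trans_lt ?_
    rw [Real.norm_of_nonneg (by positivity)]
    linarith
  have h2 := hT.nonneg _ h1 k
  simp only [Pi.zero_apply, Pi.sub_apply] at h2
  linarith

lemma IsBasicEllitopeData.zero_mem (hT : IsBasicEllitopeData T 𝒯) : (0 : Fin K → ℝ) ∈ 𝒯 := by
  obtain ⟨t, ht⟩ := hT.nonempty
  exact hT.monotone 0 t le_rfl (hT.nonneg t ht) ht

lemma IsBasicEllitopeData.supportFun_nonneg (hT : IsBasicEllitopeData T 𝒯) (l : Fin K → ℝ) :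
    0 ≤ supportFun 𝒯 l := by
  simpa using dotProduct_le_supportFun hT.isCompact l hT.zero_mem

lemma mul_le_supportFun (hT : IsBasicEllitopeData T 𝒯) {l : Fin K → ℝ} (hl : 0 ≤ l)
    {t : Fin K → ℝ} (ht : t ∈ 𝒯) (k : Fin K) : l k * t k ≤ supportFun 𝒯 l :=
  (Finset.single_le_sum (f := fun k => l k * t k)
    (fun k _ => mul_nonneg (hl k) (hT.nonneg t ht k)) (Finset.mem_univ k)).trans
    (dotProduct_le_supportFun hT.isCompact l ht)

/-- The nonnegative vectors at which the support function of `𝒯` is at most `c`. -/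
def dualBall (𝒯 : Set (Fin K → ℝ)) (c : ℝ) : Set (Fin K → ℝ) :=
  {l | 0 ≤ l ∧ supportFun 𝒯 l ≤ c}

lemma isCompact_dualBall (hT : IsBasicEllitopeData T 𝒯) (c : ℝ) : IsCompact (dualBall 𝒯 c) := by
  obtain ⟨t, ht, hpos⟩ := hT.exists_pos
  refine (isCompact_Icc (a := (0 : Fin K → ℝ)) (b := fun k => c / t k)).of_isClosed_subset ?_ ?_
  · exact (isClosed_le continuous_const continuous_id).inter
      (isClosed_le (continuous_supportFun hT.isCompact) continuous_const)
  · rintro l ⟨hl, hc⟩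
    exact ⟨hl, fun k => (le_div_iff₀ (hpos k)).2 ((mul_le_supportFun hT hl ht k).trans hc)⟩

lemma convex_dualBall (hT : IsBasicEllitopeData T 𝒯) (c : ℝ) : Convex ℝ (dualBall 𝒯 c) := by
  rintro l ⟨hl, hlc⟩ l' ⟨hl', hlc'⟩ a b ha hb hab
  refine ⟨add_nonneg (smul_nonneg ha hl) (smul_nonneg hb hl'),
    supportFun_le hT.nonempty fun t ht => ?_⟩
  have h1 := (dotProduct_le_supportFun hT.isCompact l ht).trans hlc
  have h2 := (dotProduct_le_supportFun hT.isCompact l' ht).trans hlc'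
  rw [add_dotProduct, smul_dotProduct, smul_dotProduct, smul_eq_mul, smul_eq_mul]
  calc a * (l ⬝ᵥ t) + b * (l' ⬝ᵥ t) ≤ a * c + b * c := by gcongr
    _ = c := by rw [← add_mul, hab, one_mul]

lemma zero_mem_dualBall (hT : IsBasicEllitopeData T 𝒯) {c : ℝ} (hc : 0 ≤ c) :
    0 ∈ dualBall 𝒯 c :=
  ⟨le_rfl, supportFun_le hT.nonempty fun t _ => by simpa using hc⟩

open scoped Pointwise in
/-- The bipolar theorem for `𝒯`, with the maximum attained: a nonnegative vector `a` lies in the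
multiple `(max l ⬝ a) 𝒯`, the maximum being over `l ≥ 0` with `φ_𝒯(l) ≤ 1`. Monotonicity of `𝒯` is
what allows a separating functional to be replaced by its positive part. -/
lemma exists_dualBall_eq_smul (hT : IsBasicEllitopeData T 𝒯) {a : Fin K → ℝ} (ha : 0 ≤ a) :
    ∃ l ∈ dualBall 𝒯 1, ∃ t ∈ 𝒯, a = (l ⬝ᵥ a) • t := by
  obtain ⟨l₀, hl₀, hmax⟩ := (isCompact_dualBall hT 1).exists_isMaxOn
    ⟨0, zero_mem_dualBall hT zero_le_one⟩
    (f := fun l => l ⬝ᵥ a) (Continuous.dotProduct continuous_id continuous_const).continuousOn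
  refine ⟨l₀, hl₀, ?_⟩
  set γ : ℝ := l₀ ⬝ᵥ a
  by_contra hcon
  have hγ0 : 0 ≤ γ := dotProduct_nonneg_of_nonneg hl₀.1 ha
  have hnot : a ∉ γ • 𝒯 := by
    rintro ⟨t, ht, h⟩
    exact hcon ⟨t, ht, h.symm⟩
  obtain ⟨f, u, hfu, hua⟩ := geometric_hahn_banach_closed_point (hT.convex.smul γ)
    (hT.isCompact.smul γ).isClosed hnot
  set c : Fin K → ℝ := fun k => f (Pi.single k 1) with hc
  have hf : ∀ x, f x = c ⬝ᵥ x := by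
    intro x
    conv_lhs => rw [pi_eq_sum_univ' x]
    rw [map_sum]
    refine Finset.sum_congr rfl fun k _ => ?_
    rw [map_smul, smul_eq_mul, mul_comm, hc]
  set l : Fin K → ℝ := fun k => max (c k) 0 with hl
  have hl0 : 0 ≤ l := fun k => le_max_right _ _
  have hla : u < l ⬝ᵥ a := by
    refine (hua.trans_eq (hf a)).trans_le (Finset.sum_le_sum fun k _ => ?_)
    exact mul_le_mul_of_nonneg_right (le_max_left _ _) (ha k)
  have hlt : ∀ t ∈ 𝒯, γ * (l ⬝ᵥ t) < u := by
    intro t ht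
    have h0 := hT.nonneg t ht
    have ht' : (fun k => if 0 ≤ c k then t k else 0) ∈ 𝒯 := by
      refine hT.monotone _ t (fun k => ?_) (fun k => ?_) ht
      · simp only [Pi.zero_apply]
        split_ifs
        exacts [h0 k, le_rfl]
      · simp only
        split_ifs
        exacts [le_rfl, h0 k]
    have h1 := hfu _ (Set.smul_mem_smul_set ht')
    rw [hf, dotProduct_smul, smul_eq_mul] at h1
    refine lt_of_eq_of_lt ?_ h1
    congr 1
    refine Finset.sum_congr rfl fun k _ => ?_
    simp only [hl]
    split_ifs with h
    · rw [max_eq_left h]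
    · rw [max_eq_right (not_le.1 h).le, zero_mul, mul_zero]
  have hu : 0 < u := by simpa using hlt 0 hT.zero_mem
  have hφ : 0 < supportFun 𝒯 l := by
    by_contra hle
    obtain ⟨t, ht, hpos⟩ := hT.exists_pos
    have hz : l = 0 := by
      funext k
      have h1 := (mul_le_supportFun hT hl0 ht k).trans (not_lt.1 hle)
      have h2 : l k ≤ 0 := by
        by_contra h3
        exact h1.not_gt (mul_pos (not_le.1 h3) (hpos k))
      exact le_antisymm h2 (hl0 k)
    rw [hz, zero_dotProduct] at hla
    linarith
  have hmem : (supportFun 𝒯 l)⁻¹ • l ∈ dualBall 𝒯 1 :=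
    ⟨smul_nonneg (inv_nonneg.2 hφ.le) hl0, (supportFun_smul_le hT (inv_nonneg.2 hφ.le) l).trans_eq
      (inv_mul_cancel₀ hφ.ne')⟩
  have h1 : (supportFun 𝒯 l)⁻¹ * (l ⬝ᵥ a) ≤ γ := by
    have h3 : ((supportFun 𝒯 l)⁻¹ • l) ⬝ᵥ a ≤ γ := hmax hmem
    rwa [smul_dotProduct, smul_eq_mul] at h3
  have h2 : γ * supportFun 𝒯 l ≤ u := by
    rcases hγ0.eq_or_lt with h | h
    · rw [← h, zero_mul]
      exact hu.le
    · rw [mul_comm, ← le_div_iff₀ h]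
      refine supportFun_le hT.nonempty fun t ht => ?_
      rw [le_div_iff₀ h, mul_comm]
      exact (hlt t ht).le
  rw [inv_mul_le_iff₀ hφ] at h1
  linarith

end SupportFun

/-! ### A minimax theorem for systems of concave inequalities -/

/-- A system of concave inequalities on a compact convex set is solvable if each convex combination
of finitely many of them is. Finite subsystems are handled by Sion's minimax theorem on a simplex of
weights, the whole system by compactness. -/
theorem exists_forall_nonneg_of_convexCombination {E I : Type*} [TopologicalSpace E]
    [AddCommGroup E] [Module ℝ E] [IsTopologicalAddGroup E] [ContinuousSMul ℝ E]
    {X : Set E} (hne : X.Nonempty) (hconv : Convex ℝ X) (hcomp : IsCompact X) {g : I → E → ℝ}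
    (hg : ∀ i, ConcaveOn ℝ X (g i)) (hgc : ∀ i, Continuous (g i))
    (h : ∀ (u : Finset I) (μ : u → ℝ), (∀ i, 0 ≤ μ i) → ∑ i, μ i = 1 →
      ∃ x ∈ X, 0 ≤ ∑ i, μ i * g i x) :
    ∃ x ∈ X, ∀ i, 0 ≤ g i x := by
  classical
  have key : (X ∩ ⋂ i, {x | 0 ≤ g i x}).Nonempty := by
    refine hcomp.inter_iInter_nonempty _ (fun i => isClosed_le continuous_const (hgc i)) fun u => ?_
    rcases u.eq_empty_or_nonempty with rfl | hu
    · simpa using hne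
    have hu' : Nonempty u := hu.to_subtype
    obtain ⟨x, hx, μ, hμ, hsad⟩ := Sion.exists_isSaddlePointOn hne hconv hcomp
      (Y := stdSimplex ℝ u) (f := fun x μ => -∑ i, μ i * g i x)
      (fun μ _ => by
        refine Continuous.continuousOn (Continuous.neg ?_) |>.lowerSemicontinuousOn
        exact continuous_finsetSum _ fun i _ => continuous_const.mul (hgc i))
      (fun μ hμ => by
        refine ConvexOn.quasiconvexOn (ConcaveOn.neg ?_)
        refine ⟨hconv, fun x hx y hy a b ha hb hab => ?_⟩
        rw [smul_eq_mul, smul_eq_mul, Finset.mul_sum, Finset.mul_sum, ← Finset.sum_add_distrib]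
        refine Finset.sum_le_sum fun i _ => ?_
        have := mul_le_mul_of_nonneg_left ((hg i).2 hx hy ha hb hab) (hμ.1 i)
        simp only [smul_eq_mul] at this
        linarith)
      (convex_stdSimplex ℝ u) ⟨_, single_mem_stdSimplex ℝ (Classical.arbitrary u)⟩
      (isCompact_stdSimplex ℝ u)
      (fun x _ => by
        refine Continuous.continuousOn (Continuous.neg ?_) |>.upperSemicontinuousOn
        exact continuous_finsetSum _ fun i _ => (continuous_apply i).mul continuous_const)
      (fun x _ => by
        refine ConcaveOn.quasiconcaveOn ⟨convex_stdSimplex ℝ u, fun μ _ ν _ a b _ _ _ => ?_⟩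
        refine le_of_eq ?_
        simp only [smul_eq_mul, Pi.add_apply, Pi.smul_apply, mul_neg, Finset.mul_sum, add_mul,
          Finset.sum_add_distrib, mul_assoc]
        ring)
    obtain ⟨y, hy, hy0⟩ := h u μ hμ.1 hμ.2
    refine ⟨x, hx, ?_⟩
    rw [Set.mem_iInter₂]
    intro i hi
    have h1 := hsad y hy _ (single_mem_stdSimplex ℝ (⟨i, hi⟩ : u))
    simp only [Pi.single_apply, ite_mul, one_mul, zero_mul, Finset.sum_ite_eq',
      Finset.mem_univ, if_true] at h1
    show 0 ≤ g i x
    linarith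
  obtain ⟨x, hx, hxi⟩ := key
  exact ⟨x, hx, fun i => Set.mem_iInter.1 hxi i⟩

/-! ### A nearly optimal feasible point of the semidefinite relaxation -/

section Feasible

variable {p q K L : ℕ} {T : Fin K → Matrix (Fin p) (Fin p) ℝ} {𝒯 : Set (Fin K → ℝ)}
  {S : Fin L → Matrix (Fin q) (Fin q) ℝ} {𝒮 : Set (Fin L → ℝ)}

lemma trace_conj_nonneg {ι : Type*} [Fintype ι] {r : ℕ} {R : Matrix (Fin r) (Fin r) ℝ}
    (hR : R.PosSemidef) (X : Matrix (Fin r) ι ℝ) : 0 ≤ (Xᵀ * R * X).trace := by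
  rw [trace_conj_eq_sum]
  exact Finset.sum_nonneg fun i _ => quadForm_nonneg hR _

/-- For each single matrix solution `Z`, `W` some multipliers of the prescribed size certify the
bound. The multipliers are extremal for the vectors of traces, and the bound
`ρ √α √β ≤ ρ (α + β) / 2` splits the budget `ρ` evenly. -/
lemma exists_dualBall_trace_nonneg (hT : IsBasicEllitopeData T 𝒯) (hS : IsBasicEllitopeData S 𝒮)
    {M : Matrix (Fin q) (Fin p) ℝ} {N : ℝ}
    (hN : ∀ z ∈ basicEllitope S 𝒮, ∀ w ∈ basicEllitope T 𝒯, z ⬝ᵥ M *ᵥ w ≤ N)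
    {ι : Type*} [Fintype ι] (Z : Matrix (Fin q) ι ℝ) (W : Matrix (Fin p) ι ℝ) :
    ∃ l ∈ dualBall 𝒯 (tightnessFactor K L * N / 2), ∃ u ∈ dualBall 𝒮 (tightnessFactor K L * N / 2),
      0 ≤ ∑ j, u j * (Zᵀ * S j * Z).trace + ∑ k, l k * (Wᵀ * T k * W).trace +
        (Zᵀ * M * W).trace := by
  have hρ : 0 ≤ tightnessFactor K L * N / 2 :=
    div_nonneg (mul_nonneg (tightnessFactor_nonneg K L) (nonneg_of_bilin_le hT hS hN)) two_pos.le
  have ha : (0 : Fin K → ℝ) ≤ fun k => (Wᵀ * T k * W).trace :=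
    fun k => trace_conj_nonneg (hT.posSemidef k) W
  have hb : (0 : Fin L → ℝ) ≤ fun l => (Zᵀ * S l * Z).trace :=
    fun l => trace_conj_nonneg (hS.posSemidef l) Z
  obtain ⟨l, hl, t, ht, hlt⟩ := exists_dualBall_eq_smul hT ha
  obtain ⟨u, hu, s, hs, hus⟩ := exists_dualBall_eq_smul hS hb
  set α := l ⬝ᵥ fun k => (Wᵀ * T k * W).trace with hα
  set β := u ⬝ᵥ fun l => (Zᵀ * S l * Z).trace with hβ
  have hα0 : 0 ≤ α := dotProduct_nonneg_of_nonneg hl.1 ha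
  have hβ0 : 0 ≤ β := dotProduct_nonneg_of_nonneg hu.1 hb
  -- The rounding bound is one-sided; replacing `Z` by `-Z` gives the lower bound needed here.
  have h1 := trace_le_of_trace_le hT hS hN (Z := -Z) (W := W) ht hs hα0 hβ0
    (fun k => (congrFun hlt k).le)
    (fun l => by simpa using (congrFun hus l).le)
  rw [Matrix.transpose_neg, Matrix.neg_mul, Matrix.neg_mul, Matrix.trace_neg] at h1
  have hmem : ∀ {r J : ℕ} {R : Fin J → Matrix (Fin r) (Fin r) ℝ} {𝒥 : Set (Fin J → ℝ)}
      (_ : IsBasicEllitopeData R 𝒥) {x : Fin J → ℝ} (_ : x ∈ dualBall 𝒥 1),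
      (tightnessFactor K L * N / 2) • x ∈ dualBall 𝒥 (tightnessFactor K L * N / 2) :=
    fun hR x hx => ⟨smul_nonneg hρ hx.1,
      (supportFun_smul_le hR hρ x).trans (mul_le_of_le_one_right hρ hx.2)⟩
  refine ⟨_, hmem hT hl, _, hmem hS hu, ?_⟩
  have h2 : ∑ j, ((tightnessFactor K L * N / 2) • u) j * (Zᵀ * S j * Z).trace =
      tightnessFactor K L * N / 2 * β := by
    exact smul_dotProduct (tightnessFactor K L * N / 2) u _
  have h3 : ∑ k, ((tightnessFactor K L * N / 2) • l) k * (Wᵀ * T k * W).trace =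
      tightnessFactor K L * N / 2 * α := by
    exact smul_dotProduct (tightnessFactor K L * N / 2) l _
  rw [h2, h3]
  have h4 : 0 ≤ tightnessFactor K L * N / 2 * (√α - √β) ^ 2 := mul_nonneg hρ (sq_nonneg _)
  have h5 : (√α - √β) ^ 2 = α + β - 2 * (√α * √β) := by
    rw [sub_sq, Real.sq_sqrt hα0, Real.sq_sqrt hβ0]
    ring
  rw [h5] at h4
  linarith

/-- Multipliers that certify the relaxed bound for all vectors at once. -/
theorem exists_dualBall_quadForm_nonneg (hT : IsBasicEllitopeData T 𝒯)
    (hS : IsBasicEllitopeData S 𝒮) {M : Matrix (Fin q) (Fin p) ℝ} {N : ℝ}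
    (hN : ∀ z ∈ basicEllitope S 𝒮, ∀ w ∈ basicEllitope T 𝒯, z ⬝ᵥ M *ᵥ w ≤ N) :
    ∃ l ∈ dualBall 𝒯 (tightnessFactor K L * N / 2), ∃ u ∈ dualBall 𝒮 (tightnessFactor K L * N / 2),
      ∀ (z : Fin q → ℝ) (w : Fin p → ℝ),
        0 ≤ ∑ j, u j * (z ⬝ᵥ S j *ᵥ z) + ∑ k, l k * (w ⬝ᵥ T k *ᵥ w) + z ⬝ᵥ M *ᵥ w := by
  set c := tightnessFactor K L * N / 2 with hc
  have hρ : 0 ≤ c :=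
    div_nonneg (mul_nonneg (tightnessFactor_nonneg K L) (nonneg_of_bilin_le hT hS hN)) two_pos.le
  let g : (Fin q → ℝ) × (Fin p → ℝ) → (Fin K → ℝ) × (Fin L → ℝ) → ℝ := fun x y =>
    ∑ j, y.2 j * (x.1 ⬝ᵥ S j *ᵥ x.1) + ∑ k, y.1 k * (x.2 ⬝ᵥ T k *ᵥ x.2) + x.1 ⬝ᵥ M *ᵥ x.2
  obtain ⟨⟨l, u⟩, ⟨hl, hu⟩, hlu⟩ := exists_forall_nonneg_of_convexCombination
    (X := dualBall 𝒯 c ×ˢ dualBall 𝒮 c) (g := g)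
    ⟨(0, 0), zero_mem_dualBall hT hρ, zero_mem_dualBall hS hρ⟩
    ((convex_dualBall hT c).prod (convex_dualBall hS c))
    ((isCompact_dualBall hT c).prod (isCompact_dualBall hS c))
    (fun x => ⟨(convex_dualBall hT c).prod (convex_dualBall hS c),
      fun y _ y' _ a b _ _ hab => by
        refine le_of_eq ?_
        simp only [g, smul_eq_mul, Prod.fst_add, Prod.snd_add, Prod.smul_fst, Prod.smul_snd,
          Pi.add_apply, Pi.smul_apply, add_mul, Finset.sum_add_distrib, mul_add, Finset.mul_sum,
          mul_assoc]
        linear_combination (x.1 ⬝ᵥ M *ᵥ x.2) * hab⟩)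
    (fun x => by fun_prop)
    (fun I μ hμ _ => by
      let Z : Matrix (Fin q) I ℝ := Matrix.of fun a i => √(μ i) * i.1.1 a
      let W : Matrix (Fin p) I ℝ := Matrix.of fun a i => √(μ i) * i.1.2 a
      have hZ : ∀ i, Z.col i = √(μ i) • i.1.1 := fun i => rfl
      have hW : ∀ i, W.col i = √(μ i) • i.1.2 := fun i => rfl
      obtain ⟨l, hl, u, hu, h⟩ := exists_dualBall_trace_nonneg hT hS hN Z W
      refine ⟨(l, u), ⟨hl, hu⟩, h.trans_eq ?_⟩
      simp only [trace_conj_eq_sum, hZ, hW, Matrix.mulVec_smul, smul_dotProduct, dotProduct_smul,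
        smul_eq_mul, ← mul_assoc, Real.mul_self_sqrt (hμ _)]
      simp only [g, mul_add, Finset.sum_add_distrib, Finset.mul_sum]
      rw [Finset.sum_comm]
      nth_rw 2 [Finset.sum_comm]
      congr 2
      · exact Finset.sum_congr rfl fun i _ => Finset.sum_congr rfl fun j _ => by ring
      · exact Finset.sum_congr rfl fun i _ => Finset.sum_congr rfl fun j _ => by ring)
  exact ⟨l, hl, u, hu, fun z w => hlu (z, w)⟩

end Feasible

/-! ### Compactness and convexity of ellitopes -/

section Geometry

variable {n p K : ℕ} {T : Fin K → Matrix (Fin p) (Fin p) ℝ} {𝒯 : Set (Fin K → ℝ)}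

@[fun_prop]
lemma continuous_quadForm {ι : Type*} [Fintype ι] (R : Matrix ι ι ℝ) :
    Continuous fun w : ι → ℝ => w ⬝ᵥ R *ᵥ w :=
  continuous_id.dotProduct (continuous_const.matrix_mulVec continuous_id)

lemma quadForm_convex {ι : Type*} [Fintype ι] {R : Matrix ι ι ℝ} (hR : R.PosSemidef)
    (w w' : ι → ℝ) {a b : ℝ} (ha : 0 ≤ a) (hb : 0 ≤ b) (hab : a + b = 1) :
    (a • w + b • w') ⬝ᵥ R *ᵥ (a • w + b • w') ≤ a * (w ⬝ᵥ R *ᵥ w) + b * (w' ⬝ᵥ R *ᵥ w') := by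
  have h := mul_nonneg (mul_nonneg ha hb) (quadForm_nonneg hR (w - w'))
  obtain rfl : b = 1 - a := by linarith
  simp only [Matrix.mulVec_sub, Matrix.mulVec_add, Matrix.mulVec_smul, add_dotProduct,
    dotProduct_add, sub_dotProduct, dotProduct_sub, smul_dotProduct, dotProduct_smul,
    smul_eq_mul] at h ⊢
  linarith

lemma convex_basicEllitope (hT : IsBasicEllitopeData T 𝒯) : Convex ℝ (basicEllitope T 𝒯) := by
  rintro w ⟨t, ht, hw⟩ w' ⟨t', ht', hw'⟩ a b ha hb hab
  refine ⟨a • t + b • t', hT.convex ht ht' ha hb hab, fun k => ?_⟩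
  refine (quadForm_convex (hT.posSemidef k) w w' ha hb hab).trans ?_
  simp only [Pi.add_apply, Pi.smul_apply, smul_eq_mul]
  gcongr
  exacts [hw k, hw' k]

lemma exists_norm_le_of_mem_basicEllitope (hT : IsBasicEllitopeData T 𝒯) :
    ∃ r, ∀ w ∈ basicEllitope T 𝒯, ‖w‖ ≤ r := by
  rcases (Metric.sphere (0 : Fin p → ℝ) 1).eq_empty_or_nonempty with he | hne
  · refine ⟨0, fun w _ => ?_⟩
    by_contra h
    have hw : ‖w‖ ≠ 0 := fun h0 => h h0.le
    have : (‖w‖⁻¹ • w) ∈ Metric.sphere (0 : Fin p → ℝ) 1 := by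
      simp [norm_smul, inv_mul_cancel₀ hw]
    rw [he] at this
    exact this
  obtain ⟨w₀, hw₀, hmin⟩ := (isCompact_sphere (0 : Fin p → ℝ) 1).exists_isMinOn hne
    (f := fun w => ∑ k, w ⬝ᵥ T k *ᵥ w) (by fun_prop)
  set m := ∑ k, w₀ ⬝ᵥ T k *ᵥ w₀
  have hmpos : 0 < m := hT.sum_quadForm_pos fun h0 => by simp [h0] at hw₀
  refine ⟨√(supportFun 𝒯 1 / m), fun w hw => Real.le_sqrt_of_sq_le ?_⟩
  obtain ⟨t, ht, hwt⟩ := hw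
  rcases eq_or_ne w 0 with rfl | hw0
  · simpa using div_nonneg (hT.supportFun_nonneg 1) hmpos.le
  have hnorm : ‖w‖ ≠ 0 := norm_ne_zero_iff.2 hw0
  have hsph : (‖w‖⁻¹ • w) ∈ Metric.sphere (0 : Fin p → ℝ) 1 := by
    simp [norm_smul, inv_mul_cancel₀ hnorm]
  have h1 : m ≤ (‖w‖⁻¹) ^ 2 * ∑ k, w ⬝ᵥ T k *ᵥ w := by
    refine (hmin hsph).trans_eq ?_
    simp only [quadForm_smul, ← Finset.mul_sum]
  have h2 : ∑ k, w ⬝ᵥ T k *ᵥ w ≤ supportFun 𝒯 1 := by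
    refine (Finset.sum_le_sum fun k _ => hwt k).trans ?_
    simpa [dotProduct] using dotProduct_le_supportFun hT.isCompact 1 ht
  rw [inv_pow, le_inv_mul_iff₀ (by positivity)] at h1
  rw [le_div_iff₀ hmpos]
  exact h1.trans h2

lemma isCompact_basicEllitope (hT : IsBasicEllitopeData T 𝒯) :
    IsCompact (basicEllitope T 𝒯) := by
  obtain ⟨r, hr⟩ := exists_norm_le_of_mem_basicEllitope hT
  have hC : IsCompact ((Metric.closedBall (0 : Fin p → ℝ) r ×ˢ 𝒯) ∩
      {x | ∀ k, x.1 ⬝ᵥ T k *ᵥ x.1 ≤ x.2 k}) := by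
    refine ((isCompact_closedBall _ _).prod hT.isCompact).inter_right ?_
    simp only [Set.ofPred_forall]
    exact isClosed_iInter fun k => isClosed_le ((continuous_quadForm _).comp continuous_fst)
      ((continuous_apply k).comp continuous_snd)
  convert hC.image continuous_fst
  ext w
  constructor
  · intro hw
    obtain ⟨t, ht, hwt⟩ := id hw
    exact ⟨(w, t), ⟨⟨by simpa using hr w hw, ht⟩, hwt⟩, rfl⟩
  · rintro ⟨⟨w, t⟩, ⟨⟨-, ht⟩, hwt⟩, rfl⟩
    exact ⟨t, ht, hwt⟩

lemma ellitope_eq_image (P : Matrix (Fin n) (Fin p) ℝ) :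
    ellitope P T 𝒯 = P.mulVecLin '' basicEllitope T 𝒯 := by
  ext x
  simp [ellitope, eq_comm]

lemma convex_ellitope (hT : IsBasicEllitopeData T 𝒯) (P : Matrix (Fin n) (Fin p) ℝ) :
    Convex ℝ (ellitope P T 𝒯) := by
  rw [ellitope_eq_image]
  exact (convex_basicEllitope hT).linear_image _

lemma isCompact_ellitope (hT : IsBasicEllitopeData T 𝒯) (P : Matrix (Fin n) (Fin p) ℝ) :
    IsCompact (ellitope P T 𝒯) := by
  rw [ellitope_eq_image]
  exact (isCompact_basicEllitope hT).image (continuous_const.matrix_mulVec continuous_id)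

lemma neg_mem_ellitope {P : Matrix (Fin n) (Fin p) ℝ} {x : Fin n → ℝ} (hx : x ∈ ellitope P T 𝒯) :
    -x ∈ ellitope P T 𝒯 := by
  obtain ⟨w, ⟨t, ht, hw⟩, rfl⟩ := hx
  refine ⟨-w, ⟨t, ht, fun k => ?_⟩, (Matrix.mulVec_neg w P).symm⟩
  rw [Matrix.mulVec_neg, neg_dotProduct_neg]
  exact hw k

lemma zero_mem_ellitope (hT : IsBasicEllitopeData T 𝒯) (P : Matrix (Fin n) (Fin p) ℝ) :
    0 ∈ ellitope P T 𝒯 :=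
  ⟨0, hT.zero_mem_basicEllitope, (Matrix.mulVec_zero P).symm⟩

lemma ellitope_mem_nhds_zero (hT : IsBasicEllitopeData T 𝒯) {P : Matrix (Fin n) (Fin p) ℝ}
    (hint : (interior (ellitope P T 𝒯)).Nonempty) : ellitope P T 𝒯 ∈ nhds 0 := by
  obtain ⟨x, hx⟩ := hint
  have hneg : -x ∈ interior (ellitope P T 𝒯) := by
    have h1 : (Homeomorph.neg (Fin n → ℝ)) ⁻¹' ellitope P T 𝒯 = ellitope P T 𝒯 := by
      ext y
      exact ⟨fun h => by simpa using neg_mem_ellitope h, fun h => neg_mem_ellitope h⟩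
    have h2 := (Homeomorph.neg (Fin n → ℝ)).preimage_interior (ellitope P T 𝒯)
    rw [h1] at h2
    rw [← h2] at hx
    exact hx
  have h := (convex_ellitope hT P).interior hx hneg (a := 1 / 2) (b := 1 / 2) (by norm_num)
    (by norm_num) (by norm_num)
  rw [smul_neg, add_neg_cancel] at h
  exact mem_interior_iff_mem_nhds.1 h

lemma gauge_ellitope_le_one_iff (hT : IsBasicEllitopeData T 𝒯) {P : Matrix (Fin n) (Fin p) ℝ}
    (hint : (interior (ellitope P T 𝒯)).Nonempty) (x : Fin n → ℝ) :
    gauge (ellitope P T 𝒯) x ≤ 1 ↔ x ∈ ellitope P T 𝒯 := by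
  rw [gauge_le_one_iff_mem_closure (convex_ellitope hT P) (ellitope_mem_nhds_zero hT hint),
    (isCompact_ellitope hT P).isClosed.closure_eq]

open scoped Pointwise in
/-- The norm whose unit ball is the polar of `C` is the support function of `C`. -/
lemma gauge_polar {C : Set (Fin n → ℝ)} (hC : IsCompact C) (h0 : 0 ∈ C) (v : Fin n → ℝ) :
    gauge (polar C) v = supportFun C v := by
  have hs0 : 0 ≤ supportFun C v := by simpa using dotProduct_le_supportFun hC v h0
  have hmem : ∀ r, 0 < r → supportFun C v ≤ r → v ∈ r • polar C := by
    intro r hr hle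
    refine ⟨r⁻¹ • v, fun y hy => ?_, by simp [smul_smul, hr.ne']⟩
    rw [smul_dotProduct, smul_eq_mul, inv_mul_le_iff₀ hr, mul_one]
    exact (dotProduct_le_supportFun hC v hy).trans hle
  apply le_antisymm
  · refine le_of_forall_pos_le_add fun ε hε => ?_
    exact gauge_le_of_mem (by positivity) (hmem _ (by positivity) (by linarith))
  · rw [gauge_def]
    refine le_csInf ⟨supportFun C v + 1, by simp only [Set.mem_Ioi]; positivity,
      hmem _ (by positivity) (by linarith)⟩ ?_
    rintro r ⟨hr, v', hv', rfl⟩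
    refine supportFun_le ⟨0, h0⟩ fun y hy => ?_
    have hr' : (0 : ℝ) < r := hr
    simp only [smul_dotProduct, smul_eq_mul]
    exact mul_le_of_le_one_right hr'.le (hv' y hy)

end Geometry

/-! ### Weak duality and attainment -/

section Relaxation

variable {n m p q K L : ℕ} {T : Fin K → Matrix (Fin p) (Fin p) ℝ} {𝒯 : Set (Fin K → ℝ)}
  {S : Fin L → Matrix (Fin q) (Fin q) ℝ} {𝒮 : Set (Fin L → ℝ)}

lemma posSemidef_fromBlocks_iff (hT : ∀ k, (T k).PosSemidef) (hS : ∀ j, (S j).PosSemidef)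
    (P : Matrix (Fin n) (Fin p) ℝ) (Q : Matrix (Fin m) (Fin q) ℝ) (A : Matrix (Fin m) (Fin n) ℝ)
    (l : Fin K → ℝ) (u : Fin L → ℝ) :
    (Matrix.fromBlocks (∑ j, u j • S j) ((1 / 2 : ℝ) • (Qᵀ * A * P))
      ((1 / 2 : ℝ) • (Pᵀ * Aᵀ * Q)) (∑ k, l k • T k)).PosSemidef ↔
    ∀ (z : Fin q → ℝ) (w : Fin p → ℝ), 0 ≤ ∑ j, u j * (z ⬝ᵥ S j *ᵥ z) +
      ∑ k, l k * (w ⬝ᵥ T k *ᵥ w) + z ⬝ᵥ (Qᵀ * A * P) *ᵥ w := by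
  have hsymm : ∀ {r J : ℕ} {R : Fin J → Matrix (Fin r) (Fin r) ℝ}, (∀ j, (R j).PosSemidef) →
      ∀ c : Fin J → ℝ, (∑ j, c j • R j)ᵀ = ∑ j, c j • R j := by
    intro r J R hR c
    rw [Matrix.transpose_sum]
    refine Finset.sum_congr rfl fun j _ => ?_
    rw [Matrix.transpose_smul]
    congr 1
    simpa using (hR j).isHermitian.eq
  have hM : (Qᵀ * A * P)ᵀ = Pᵀ * Aᵀ * Q := by
    simp [Matrix.transpose_mul, Matrix.mul_assoc]
  have hsum : ∀ {r J : ℕ} (R : Fin J → Matrix (Fin r) (Fin r) ℝ) (c : Fin J → ℝ) (x : Fin r → ℝ),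
      x ⬝ᵥ (∑ j, c j • R j) *ᵥ x = ∑ j, c j * (x ⬝ᵥ R j *ᵥ x) := by
    intro r J R c x
    rw [Matrix.sum_mulVec, dotProduct_sum]
    exact Finset.sum_congr rfl fun j _ => by rw [Matrix.smul_mulVec, dotProduct_smul, smul_eq_mul]
  have hform : ∀ (z : Fin q → ℝ) (w : Fin p → ℝ),
      Sum.elim z w ⬝ᵥ (Matrix.fromBlocks (∑ j, u j • S j) ((1 / 2 : ℝ) • (Qᵀ * A * P))
        ((1 / 2 : ℝ) • (Pᵀ * Aᵀ * Q)) (∑ k, l k • T k)) *ᵥ Sum.elim z w =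
      ∑ j, u j * (z ⬝ᵥ S j *ᵥ z) + ∑ k, l k * (w ⬝ᵥ T k *ᵥ w) + z ⬝ᵥ (Qᵀ * A * P) *ᵥ w := by
    intro z w
    have hc : w ⬝ᵥ (Pᵀ * Aᵀ * Q) *ᵥ z = z ⬝ᵥ (Qᵀ * A * P) *ᵥ w := by
      rw [← hM, Matrix.mulVec_transpose, dotProduct_comm, ← Matrix.dotProduct_mulVec]
    rw [Matrix.fromBlocks_mulVec, Sum.elim_comp_inl, Sum.elim_comp_inr,
      sumElim_dotProduct_sumElim, dotProduct_add, dotProduct_add, hsum, hsum,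
      Matrix.smul_mulVec, Matrix.smul_mulVec, dotProduct_smul,
      dotProduct_smul, hc, smul_eq_mul]
    ring
  constructor
  · intro h z w
    rw [← hform]
    exact quadForm_nonneg h _
  · intro h
    refine Matrix.PosSemidef.of_dotProduct_mulVec_nonneg ?_ fun x => ?_
    · rw [Matrix.IsHermitian, Matrix.conjTranspose_eq_transpose_of_trivial,
        Matrix.fromBlocks_transpose, hsymm hS, hsymm hT, Matrix.transpose_smul,
        Matrix.transpose_smul, hM, ← hM, Matrix.transpose_transpose]
    · rw [star_trivial, ← Sum.elim_comp_inl_inr x, hform]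
      exact h _ _

/-- Weak duality: a feasible point of the relaxation bounds the bilinear form. -/
lemma bilin_le_of_feasible (hT : IsBasicEllitopeData T 𝒯) (hS : IsBasicEllitopeData S 𝒮)
    {M : Matrix (Fin q) (Fin p) ℝ} {l : Fin K → ℝ} {u : Fin L → ℝ} (hl : 0 ≤ l) (hu : 0 ≤ u)
    (h : ∀ (z : Fin q → ℝ) (w : Fin p → ℝ), 0 ≤ ∑ j, u j * (z ⬝ᵥ S j *ᵥ z) +
      ∑ k, l k * (w ⬝ᵥ T k *ᵥ w) + z ⬝ᵥ M *ᵥ w)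
    {z : Fin q → ℝ} (hz : z ∈ basicEllitope S 𝒮) {w : Fin p → ℝ} (hw : w ∈ basicEllitope T 𝒯) :
    z ⬝ᵥ M *ᵥ w ≤ supportFun 𝒯 l + supportFun 𝒮 u := by
  obtain ⟨s, hs, hzs⟩ := hz
  obtain ⟨t, ht, hwt⟩ := hw
  have h1 := h (-z) w
  simp only [neg_dotProduct, Matrix.mulVec_neg, dotProduct_neg, neg_neg] at h1
  have h2 : ∑ j, u j * (z ⬝ᵥ S j *ᵥ z) ≤ supportFun 𝒮 u :=
    (Finset.sum_le_sum fun j _ => mul_le_mul_of_nonneg_left (hzs j) (hu j)).trans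
      (dotProduct_le_supportFun hS.isCompact u hs)
  have h3 : ∑ k, l k * (w ⬝ᵥ T k *ᵥ w) ≤ supportFun 𝒯 l :=
    (Finset.sum_le_sum fun k _ => mul_le_mul_of_nonneg_left (hwt k) (hl k)).trans
      (dotProduct_le_supportFun hT.isCompact l ht)
  linarith

/-- The relaxation attains its minimum as soon as it has a feasible point: the objective bounds both
support functions, so its sublevel sets are compact. -/
lemma isLeast_relaxationValues (hT : IsBasicEllitopeData T 𝒯) (hS : IsBasicEllitopeData S 𝒮)
    (P : Matrix (Fin n) (Fin p) ℝ) (Q : Matrix (Fin m) (Fin q) ℝ) (A : Matrix (Fin m) (Fin n) ℝ)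
    (hne : (relaxationValues P T 𝒯 Q S 𝒮 A).Nonempty) :
    IsLeast (relaxationValues P T 𝒯 Q S 𝒮 A) (relaxationOpt P T 𝒯 Q S 𝒮 A) := by
  obtain ⟨r₀, l₀, u₀, hl₀, hu₀, hps₀, hr₀⟩ := hne
  rw [posSemidef_fromBlocks_iff hT.posSemidef hS.posSemidef] at hps₀
  let D : Set ((Fin K → ℝ) × (Fin L → ℝ)) := (dualBall 𝒯 r₀ ×ˢ dualBall 𝒮 r₀) ∩
    {y | ∀ (z : Fin q → ℝ) (w : Fin p → ℝ), 0 ≤ ∑ j, y.2 j * (z ⬝ᵥ S j *ᵥ z) +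
      ∑ k, y.1 k * (w ⬝ᵥ T k *ᵥ w) + z ⬝ᵥ (Qᵀ * A * P) *ᵥ w}
  have hD : IsCompact D := by
    refine ((isCompact_dualBall hT r₀).prod (isCompact_dualBall hS r₀)).inter_right ?_
    simp only [Set.ofPred_forall]
    exact isClosed_iInter fun z => isClosed_iInter fun w =>
      isClosed_le continuous_const (by fun_prop)
  have h0T := hT.supportFun_nonneg
  have h0S := hS.supportFun_nonneg
  have hD₀ : (l₀, u₀) ∈ D := by
    refine ⟨⟨⟨hl₀, ?_⟩, hu₀, ?_⟩, hps₀⟩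
    · linarith [h0S u₀]
    · linarith [h0T l₀]
  obtain ⟨⟨l, u⟩, hlu, hmin⟩ := hD.exists_isMinOn ⟨_, hD₀⟩
    (f := fun y => supportFun 𝒯 y.1 + supportFun 𝒮 y.2)
    (((continuous_supportFun hT.isCompact).comp continuous_fst).add
      ((continuous_supportFun hS.isCompact).comp continuous_snd)).continuousOn
  have hleast : IsLeast (relaxationValues P T 𝒯 Q S 𝒮 A) (supportFun 𝒯 l + supportFun 𝒮 u) := by
    refine ⟨⟨l, u, hlu.1.1.1, hlu.1.2.1,
      (posSemidef_fromBlocks_iff hT.posSemidef hS.posSemidef P Q A l u).2 hlu.2, rfl⟩, ?_⟩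
    rintro r ⟨l', u', hl', hu', hps, rfl⟩
    rw [posSemidef_fromBlocks_iff hT.posSemidef hS.posSemidef] at hps
    by_cases hle : supportFun 𝒯 l' + supportFun 𝒮 u' ≤ r₀
    · exact hmin (a := (l', u')) ⟨⟨⟨hl', by linarith [h0S u']⟩, hu', by linarith [h0T l']⟩, hps⟩
    · have h1 : supportFun 𝒯 l + supportFun 𝒮 u ≤ supportFun 𝒯 l₀ + supportFun 𝒮 u₀ := hmin hD₀
      linarith
  rw [relaxationOpt, hleast.csInf_eq]
  exact hleast

end Relaxation

end EllitopicNorm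

open EllitopicNorm in
theorem mainTheorem1 {n m p q K L : ℕ}
    (X : Set (Fin n → ℝ)) (B Bstar : Set (Fin m → ℝ))
    (P : Matrix (Fin n) (Fin p) ℝ) (T : Fin K → Matrix (Fin p) (Fin p) ℝ) (𝒯 : Set (Fin K → ℝ))
    (Q : Matrix (Fin m) (Fin q) ℝ) (S : Fin L → Matrix (Fin q) (Fin q) ℝ) (𝒮 : Set (Fin L → ℝ))
    (hT : EllitopicNorm.IsBasicEllitopeData T 𝒯) (hS : EllitopicNorm.IsBasicEllitopeData S 𝒮)
    (hX : X = EllitopicNorm.ellitope P T 𝒯) (hXint : (interior X).Nonempty)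
    (hB : B = EllitopicNorm.polar Bstar) (hBstar : Bstar = EllitopicNorm.polar B)
    (hBstar_ell : Bstar = EllitopicNorm.ellitope Q S 𝒮) (hBstarint : (interior Bstar).Nonempty)
    (A : Matrix (Fin m) (Fin n) ℝ) :
    IsGreatest (EllitopicNorm.inducedNormValues B X A) (EllitopicNorm.inducedNorm B X A) ∧
    IsLeast (EllitopicNorm.relaxationValues P T 𝒯 Q S 𝒮 A)
      (EllitopicNorm.relaxationOpt P T 𝒯 Q S 𝒮 A) ∧
    EllitopicNorm.inducedNorm B X A ≤ EllitopicNorm.relaxationOpt P T 𝒯 Q S 𝒮 A ∧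
    EllitopicNorm.relaxationOpt P T 𝒯 Q S 𝒮 A ≤
      EllitopicNorm.tightnessFactor K L * EllitopicNorm.inducedNorm B X A := by
  have hBc : IsCompact Bstar := hBstar_ell ▸ isCompact_ellitope hS Q
  have hB0 : (0 : Fin m → ℝ) ∈ Bstar := hBstar_ell ▸ zero_mem_ellitope hS Q
  have hXc : IsCompact X := hX ▸ isCompact_ellitope hT P
  have hX0 : (0 : Fin n → ℝ) ∈ X := hX ▸ zero_mem_ellitope hT P
  have hvals : inducedNormValues B X A = (fun x => supportFun Bstar (A *ᵥ x)) '' X := by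
    ext r
    simp only [inducedNormValues, Set.mem_image, hB, gauge_polar hBc hB0, Set.mem_ofPred_eq]
    subst hX
    simp only [gauge_ellitope_le_one_iff hT hXint, eq_comm]
  have hgreat : IsGreatest (inducedNormValues B X A) (inducedNorm B X A) := by
    rw [inducedNorm, hvals]
    exact (hXc.image ((continuous_supportFun hBc).comp
      (continuous_const.matrix_mulVec continuous_id))).isGreatest_sSup
        (Set.Nonempty.image _ ⟨0, hX0⟩)
  -- The induced norm is the maximum of the bilinear form of `Qᵀ A P` over the basic ellitopes.
  have hbil : ∀ (z : Fin q → ℝ) (w : Fin p → ℝ),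
      (A *ᵥ P *ᵥ w) ⬝ᵥ (Q *ᵥ z) = z ⬝ᵥ (Qᵀ * A * P) *ᵥ w := by
    intro z w
    rw [dotProduct_comm, Matrix.mul_assoc, ← Matrix.mulVec_mulVec, Matrix.dotProduct_mulVec z,
      Matrix.vecMul_transpose, ← Matrix.mulVec_mulVec]
  have hN : ∀ z ∈ basicEllitope S 𝒮, ∀ w ∈ basicEllitope T 𝒯,
      z ⬝ᵥ (Qᵀ * A * P) *ᵥ w ≤ inducedNorm B X A := by
    intro z hz w hw
    have hPw : P *ᵥ w ∈ X := hX ▸ ⟨w, hw, rfl⟩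
    have hQz : Q *ᵥ z ∈ Bstar := hBstar_ell ▸ ⟨z, hz, rfl⟩
    rw [← hbil]
    refine (dotProduct_le_supportFun hBc _ hQz).trans (hgreat.2 ?_)
    rw [hvals]
    exact ⟨_, hPw, rfl⟩
  obtain ⟨l, hl, u, hu, hlu⟩ := exists_dualBall_quadForm_nonneg hT hS hN
  have hmem : supportFun 𝒯 l + supportFun 𝒮 u ∈ relaxationValues P T 𝒯 Q S 𝒮 A :=
    ⟨l, u, hl.1, hu.1,
      (posSemidef_fromBlocks_iff hT.posSemidef hS.posSemidef P Q A l u).2 hlu, rfl⟩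
  have hleast := isLeast_relaxationValues hT hS P Q A ⟨_, hmem⟩
  refine ⟨hgreat, hleast, ?_, ?_⟩
  · obtain ⟨l', u', hl', hu', hps, hopt⟩ := hleast.1
    rw [posSemidef_fromBlocks_iff hT.posSemidef hS.posSemidef] at hps
    have h1 := hgreat.1
    rw [hvals] at h1
    obtain ⟨x, hx, hxN⟩ := h1
    rw [← hxN, hopt]
    refine supportFun_le ⟨0, hB0⟩ fun y hy => ?_
    rw [hX] at hx
    rw [hBstar_ell] at hy
    obtain ⟨w, hw, rfl⟩ := hx
    obtain ⟨z, hz, rfl⟩ := hy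
    rw [hbil]
    exact bilin_le_of_feasible hT hS hl' hu' hps hz hw
  · have h1 := hleast.2 hmem
    linarith [hl.2, hu.2]
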